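/- **Theorem 4.1.** Let $\mu$ and $\mu^{(1)}$ be nontrivial probability measures on the unit circle $\partial\mathbb D$ (nontrivial: not supported on a finite set). Let $\Phi_n$ be the monic orthogonal polynomials of $\mu$, and let $\alpha_n$ be its Verblunsky coefficients, i.e. $\Phi_{n+1}(z)=z\Phi_n(z)-\bar\alpha_n\Phi_n^*(z)$ with $\Phi_n^*(z)=z^n\,\overline{\Phi_n(1/\bar z)}$; let $\alpha^{(1)}_n$ be the Verblunsky coefficients of $\mu^{(1)}$. Suppose that $$\alpha_j^{(1)}=\alpha_{j+1}\qquad (j=0,1,2,\dots),$$ and that $d\mu=w(\theta)\frac{d\theta}{2\pi}+d\mu_{\rm s}$ and $d\mu^{(1)}=w_1(\theta)\frac{d\theta}{2\pi}+d\mu^{(1)}_{\rm s}$ with $w,w_1\ge 0$ and $\mu_{\rm s},\mu^{(1)}_{\rm s}$ singular with respect to $d\theta$. Let $F(z)=\int\frac{e^{i\theta}+z}{e^{i\theta}-z}\,d\mu(\theta)$, let the Schur function $f$ of $\mu$ be defined on $\mathbb D=\{|z|<1\}$ by $F(z)=\frac{1+zf(z)}{1-zf(z)}$, let $f_1$ be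 the Schur function of $\mu^{(1)}$ defined in the same way, put $\rho_0=(1-|\alpha_0|^2)^{1/2}$, and define the relative Szegő function $$(\delta_0D)(z)=\frac{1-\bar\alpha_0 f(z)}{\rho_0}\cdot\frac{1-zf_1(z)}{1-zf(z)},\qquad z\in\mathbb D .$$ Then: 1. For a.e. $\theta$ (with respect to $\frac{d\theta}{2\pi}$), the limit $(\delta_0D)(e^{i\theta}):=\lim_{r\uparrow1}(\delta_0D)(re^{i\theta})$ exists in $\mathbb C$. 2. For a.e. $\theta$ such that $w(\theta)\ne0$, one has $w_1(\theta)\ne0$ and $$\frac{w(\theta)}{w_1(\theta)}=\bigl|(\delta_0D)(e^{i\theta})\bigr|^2 .$$ -/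

import Mathlib

open MeasureTheory Filter Topology Polynomial

namespace OPUC

/-- The unit circle `∂𝔻`, parametrised by the angle `θ ∈ ℝ / 2πℤ`. -/
abbrev UnitCircle : Type := AddCircle (2 * Real.pi)

instance instFactTwoPiPos : Fact (0 < 2 * Real.pi) := ⟨Real.two_pi_pos⟩

/-- The point `e^{iθ}` of the complex plane. -/
noncomputable def pt (θ : UnitCircle) : ℂ := (AddCircle.toCircle θ : ℂ)

/-- The normalized Lebesgue measure `dθ/2π` on the unit circle. -/
noncomputable def arc : Measure UnitCircle := AddCircle.haarAddCircle

/-- A measure is nontrivial if it is not supported on a finite set. -/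
def IsNontrivial (μ : Measure UnitCircle) : Prop :=
  ∀ s : Set UnitCircle, s.Finite → μ sᶜ ≠ 0

/-- The inner product `⟨P, Q⟩ = ∫ conj(P(e^{iθ})) Q(e^{iθ}) dμ(θ)` of polynomials in `L²(∂𝔻, dμ)`. -/
noncomputable def ip (μ : Measure UnitCircle) (P Q : ℂ[X]) : ℂ :=
  ∫ θ, (starRingEnd ℂ) (P.eval (pt θ)) * Q.eval (pt θ) ∂μ

/-- The monic orthogonal polynomials `Φ_n` of `μ`, obtained from `1, z, z², …` by the Gram–Schmidt
procedure. -/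
noncomputable def monicOP (μ : Measure UnitCircle) (n : ℕ) : ℂ[X] :=
  X ^ n - ∑ k : Fin n,
    C (ip μ (monicOP μ k) (X ^ n) / ip μ (monicOP μ k) (monicOP μ k)) * monicOP μ k
termination_by n
decreasing_by exact k.isLt

/-- The reversed polynomial `Q^*(z) = z^n conj(Q(1 / conj z))` with respect to the degree `n`. -/
noncomputable def reversed (n : ℕ) (Q : ℂ[X]) : ℂ[X] :=
  (Q.map (starRingEnd ℂ)).reflect n

/-- The Verblunsky coefficients of `μ`: the numbers `α_n` in the Szegő recursion
`Φ_{n+1}(z) = z Φ_n(z) - conj(α_n) Φ_n^*(z)`. They are read off at `z = 0`, where `Φ_n^*(0) = 1`;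
`szego_recursion` and `szego_recursion_reversed` below say that the recursion then holds. -/
noncomputable def verblunsky (μ : Measure UnitCircle) (n : ℕ) : ℂ :=
  -(starRingEnd ℂ) ((monicOP μ (n + 1)).eval 0)

/-- The Carathéodory function `F(z) = ∫ (e^{iθ} + z) / (e^{iθ} - z) dμ(θ)`. -/
noncomputable def caratheodory (μ : Measure UnitCircle) (z : ℂ) : ℂ :=
  ∫ θ, (pt θ + z) / (pt θ - z) ∂μ

/-- The Schur function `f` of `μ`, determined on the unit disk by
`F(z) = (1 + z f(z)) / (1 - z f(z))`: it is the quotient of `(F(z) - 1) / (F(z) + 1)`, which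
vanishes at `0` if `μ` is a probability measure, by `z` (and at `z = 0` the derivative there). -/
noncomputable def schur (μ : Measure UnitCircle) : ℂ → ℂ :=
  dslope (fun z => (caratheodory μ z - 1) / (caratheodory μ z + 1)) 0

/-- The relative Szegő function
`(δ₀D)(z) = (1 - conj(α₀) f(z)) / ρ₀ * ((1 - z f₁(z)) / (1 - z f(z)))`, with
`ρ₀ = (1 - |α₀|²)^{1/2}`, where `α₀` and `f` belong to `μ` and `f₁` is the Schur function of `μ₁`. -/
noncomputable def relativeSzego (μ μ₁ : Measure UnitCircle) (z : ℂ) : ℂ :=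
  (1 - (starRingEnd ℂ) (verblunsky μ 0) * schur μ z) /
      (Real.sqrt (1 - ‖verblunsky μ 0‖ ^ 2) : ℂ) *
    ((1 - z * schur μ₁ z) / (1 - z * schur μ z))

/-- `w` is the weight of the absolutely continuous part of `μ`:
`dμ = w dθ/2π + dμ_s` with `w ≥ 0` and `μ_s` singular. -/
def IsACWeight (μ : Measure UnitCircle) (w : UnitCircle → ℝ) : Prop :=
  AEMeasurable w arc ∧ (∀ᵐ θ ∂arc, 0 ≤ w θ) ∧
    ∃ μs : Measure UnitCircle, μs ⟂ₘ arc ∧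
      μ = arc.withDensity (fun θ => ENNReal.ofReal (w θ)) + μs

lemma pt_mul_conj (θ : UnitCircle) : pt θ * (starRingEnd ℂ) (pt θ) = 1 := by
  simp [pt, Complex.mul_conj]

lemma continuous_pt : Continuous pt :=
  continuous_subtype_val.comp AddCircle.continuous_toCircle

lemma pt_injective : Function.Injective pt := fun a b h =>
  AddCircle.injective_toCircle (by positivity) (Subtype.ext h)

section
set_option linter.unusedSectionVars false
variable {μ : Measure UnitCircle} [IsFiniteMeasure μ]

lemma integrable_ip (P Q : ℂ[X]) :
    Integrable (fun θ => (starRingEnd ℂ) (P.eval (pt θ)) * Q.eval (pt θ)) μ := by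
  have hc : Continuous (fun θ => (starRingEnd ℂ) (P.eval (pt θ)) * Q.eval (pt θ)) :=
    (Complex.continuous_conj.comp (P.continuous.comp continuous_pt)).mul
      (Q.continuous.comp continuous_pt)
  exact hc.integrable_of_hasCompactSupport (HasCompactSupport.of_compactSpace _)

lemma ip_add (P Q R : ℂ[X]) : ip μ P (Q + R) = ip μ P Q + ip μ P R := by
  unfold ip
  rw [← integral_add (integrable_ip P Q) (integrable_ip P R)]
  simp [mul_add]

lemma ip_C_mul (P Q : ℂ[X]) (c : ℂ) : ip μ P (C c * Q) = c * ip μ P Q := by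
  unfold ip
  rw [← integral_const_mul]
  congr 1
  ext θ
  simp only [eval_mul, eval_C]
  ring

lemma ip_conj (P Q : ℂ[X]) : (starRingEnd ℂ) (ip μ P Q) = ip μ Q P := by
  unfold ip
  rw [← integral_conj]
  congr 1
  ext θ
  simp [mul_comm]

lemma ip_sub (P Q R : ℂ[X]) : ip μ P (Q - R) = ip μ P Q - ip μ P R := by
  have h := ip_add (μ := μ) P Q (C (-1) * R)
  rw [ip_C_mul] at h
  have e : Q - R = Q + C (-1) * R := by simp [sub_eq_add_neg]
  rw [e, h]
  ring

lemma ip_zero (P : ℂ[X]) : ip μ P 0 = 0 := by simp [ip]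

lemma ip_sum {ι : Type*} (s : Finset ι) (P : ℂ[X]) (Q : ι → ℂ[X]) :
    ip μ P (∑ i ∈ s, Q i) = ∑ i ∈ s, ip μ P (Q i) := by
  classical
  induction s using Finset.induction_on with
  | empty => simp [ip_zero]
  | insert a s ha ih => rw [Finset.sum_insert ha, Finset.sum_insert ha, ip_add, ih]

lemma eq_zero_of_ip_self (hμ : IsNontrivial μ) {P : ℂ[X]} (h : ip μ P P = 0) : P = 0 := by
  by_contra hP
  have e : ∀ θ, (starRingEnd ℂ) (P.eval (pt θ)) * P.eval (pt θ) =
      ((‖P.eval (pt θ)‖ ^ 2 : ℝ) : ℂ) := fun θ => by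
    rw [mul_comm, Complex.mul_conj, Complex.normSq_eq_norm_sq]
  have h1 : ∫ θ, ‖P.eval (pt θ)‖ ^ 2 ∂μ = 0 := by
    have : ((∫ θ, ‖P.eval (pt θ)‖ ^ 2 ∂μ : ℝ) : ℂ) = 0 := by
      rw [← h, ip]
      simp only [e]
      exact integral_ofReal.symm
    exact_mod_cast this
  have hi : Integrable (fun θ => ‖P.eval (pt θ)‖ ^ 2) μ :=
    ((P.continuous.comp continuous_pt).norm.pow 2).integrable_of_hasCompactSupport
      (HasCompactSupport.of_compactSpace _)
  have h2 := (integral_eq_zero_iff_of_nonneg (fun θ => by positivity) hi).1 h1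
  refine hμ (pt ⁻¹' {z | P.IsRoot z})
    (Set.Finite.preimage pt_injective.injOn (finite_setOfPred_isRoot hP)) ?_
  refine measure_mono_null ?_ h2
  intro θ hθ h0
  apply hθ
  simpa using h0

lemma degree_C_mul_le' (c : ℂ) (P : ℂ[X]) : (C c * P).degree ≤ P.degree := by
  rw [← smul_eq_C_mul]
  exact degree_smul_le _ _

lemma monicOP_aux (n : ℕ) :
    (monicOP μ n).Monic ∧ (monicOP μ n).natDegree = n := by
  induction n using Nat.strong_induction_on with
  | _ n ih =>
    have hd : degree (∑ k : Fin n, C (ip μ (monicOP μ k) (X ^ n) /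
        ip μ (monicOP μ k) (monicOP μ k)) * monicOP μ k) < n := by
      rw [← mem_degreeLT]
      refine Submodule.sum_mem _ fun k _ => ?_
      rw [mem_degreeLT]
      refine lt_of_le_of_lt (degree_C_mul_le' _ _) ?_
      rw [degree_eq_natDegree (ih k k.2).1.ne_zero, (ih k k.2).2]
      exact_mod_cast k.2
    rw [monicOP]
    refine ⟨monic_X_pow_sub hd, ?_⟩
    rw [sub_eq_add_neg]
    apply natDegree_eq_of_degree_eq_some
    rw [degree_add_eq_left_of_degree_lt] <;> simp [hd]

lemma ip_monicOP_lt (hμ : IsNontrivial μ) (n : ℕ) :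
    ∀ j < n, ip μ (monicOP μ j) (monicOP μ n) = 0 := by
  induction n using Nat.strong_induction_on with
  | _ n ih =>
    intro j hj
    have hne : ip μ (monicOP μ j) (monicOP μ j) ≠ 0 := fun h =>
      (monicOP_aux j).1.ne_zero (eq_zero_of_ip_self hμ h)
    rw [monicOP.eq_1 μ n, ip_sub, ip_sum]
    rw [Finset.sum_eq_single (⟨j, hj⟩ : Fin n)]
    · rw [ip_C_mul, div_mul_cancel₀ _ hne, sub_self]
    · intro k _ hk
      rw [ip_C_mul]
      have hkj : (k : ℕ) ≠ j := fun h => hk (Fin.ext h)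
      rcases lt_or_gt_of_ne hkj with h | h
      · rw [← ip_conj (monicOP μ k) (monicOP μ j), ih j hj k h, map_zero, mul_zero]
      · rw [ih k k.2 j h, mul_zero]
    · simp

lemma ip_monicOP_of_natDegree_lt (hμ : IsNontrivial μ) {n : ℕ} :
    ∀ (m : ℕ) (P : ℂ[X]), m ≤ n → P.degree < m → ip μ (monicOP μ n) P = 0 := by
  intro m
  induction m with
  | zero =>
    intro P _ hP
    have : P = 0 := by
      rw [← degree_eq_bot]
      exact Nat.WithBot.lt_zero_iff.1 hP
    rw [this, ip_zero]
  | succ m ih =>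
    intro P hm hP
    set Q := P - C (P.coeff m) * monicOP μ m with hQ
    have hle : P.degree ≤ m := Order.lt_succ_iff.1 (by exact_mod_cast hP)
    have hdm : (monicOP μ m).degree = m := by
      rw [degree_eq_natDegree (monicOP_aux m).1.ne_zero, (monicOP_aux m).2]
    have hQd : Q.degree < m := by
      rw [degree_lt_iff_coeff_zero]
      intro k hk
      rcases hk.lt_or_eq with h | h
      · rw [hQ, coeff_sub, coeff_C_mul, coeff_eq_zero_of_degree_lt (lt_of_le_of_lt hle
          (by exact_mod_cast h)), coeff_eq_zero_of_degree_lt (lt_of_le_of_lt hdm.le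
          (by exact_mod_cast h))]
        simp
      · have h1 : (monicOP μ m).coeff m = 1 := by
          have := (monicOP_aux (μ := μ) m).1
          rwa [Monic, leadingCoeff, (monicOP_aux m).2] at this
        rw [← h, hQ, coeff_sub, coeff_C_mul, h1]
        simp
    have e : P = Q + C (P.coeff m) * monicOP μ m := by rw [hQ]; ring
    rw [e, ip_add, ip_C_mul, ih Q (by omega) hQd, ← ip_conj, ip_monicOP_lt hμ n m (by omega)]
    simp

lemma reversed_eval (n : ℕ) {Q : ℂ[X]} (hQ : Q.natDegree ≤ n) (θ : UnitCircle) :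
    (reversed n Q).eval (pt θ) = pt θ ^ n * (starRingEnd ℂ) (Q.eval (pt θ)) := by
  have hu : pt θ * (starRingEnd ℂ) (pt θ) = 1 := pt_mul_conj θ
  have h0 : pt θ ≠ 0 := left_ne_zero_of_mul_eq_one hu
  have hinv : (pt θ)⁻¹ = (starRingEnd ℂ) (pt θ) := inv_eq_of_mul_eq_one_right hu
  let _ : Invertible ((starRingEnd ℂ) (pt θ)) := invertibleOfNonzero (by simpa using h0)
  have h := eval₂_reflect_mul_pow (RingHom.id ℂ) ((starRingEnd ℂ) (pt θ)) n
    (Q.map (starRingEnd ℂ)) (by simpa using hQ)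
  have hi : ⅟((starRingEnd ℂ) (pt θ)) = pt θ := by
    rw [invOf_eq_inv, ← hinv, inv_inv]
  rw [hi] at h
  simp only [eval₂_id, eval_map] at h
  rw [eval₂_hom] at h
  rw [reversed, ← h, mul_comm, mul_assoc, ← mul_pow, mul_comm _ (pt θ), hu]
  simp

lemma ip_X_mul (P Q : ℂ[X]) : ip μ (X * P) (X * Q) = ip μ P Q := by
  unfold ip
  congr 1
  ext θ
  simp only [eval_mul, eval_X, map_mul]
  linear_combination (starRingEnd ℂ (P.eval (pt θ)) * Q.eval (pt θ)) * pt_mul_conj θ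

lemma ip_X_mul_reversed {n : ℕ} {P Q : ℂ[X]} (hP : P.natDegree ≤ n) (hQ : Q.natDegree ≤ n + 1) :
    ip μ (X * P) (reversed (n + 1) Q) = ip μ Q (reversed n P) := by
  unfold ip
  congr 1
  ext θ
  rw [reversed_eval _ hP, reversed_eval _ hQ]
  simp only [eval_mul, eval_X, map_mul]
  linear_combination (starRingEnd ℂ (P.eval (pt θ)) * pt θ ^ n *
    starRingEnd ℂ (Q.eval (pt θ))) * pt_mul_conj θ

lemma natDegree_reversed_le {n : ℕ} {Q : ℂ[X]} (hQ : Q.natDegree ≤ n) :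
    (reversed n Q).natDegree ≤ n := by
  refine (natDegree_reflect_le).trans ?_
  simpa using hQ

lemma reversed_eval_zero (n : ℕ) : (reversed n (monicOP μ n)).eval 0 = 1 := by
  have h := (monicOP_aux (μ := μ) n).1
  rw [Monic, leadingCoeff, (monicOP_aux n).2] at h
  rw [← coeff_zero_eq_eval_zero, reversed, coeff_reflect, revAt_zero, coeff_map, h, map_one]

/-- The Szegő recursion. -/
theorem szego_recursion (hμ : IsNontrivial μ) (n : ℕ) :
    monicOP μ (n + 1) =
      X * monicOP μ n - C ((starRingEnd ℂ) (verblunsky μ n)) * reversed n (monicOP μ n) := by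
  set a := (starRingEnd ℂ) (verblunsky μ n) with ha
  have ha' : a = -(monicOP μ (n + 1)).eval 0 := by simp [ha, verblunsky]
  set D := monicOP μ (n + 1) - X * monicOP μ n + C a * reversed n (monicOP μ n) with hD
  suffices h : D = 0 by rw [hD] at h; linear_combination h
  have hn := monicOP_aux (μ := μ) n
  have hn1 := monicOP_aux (μ := μ) (n + 1)
  have hXd : (X * monicOP μ n).natDegree = n + 1 := by
    rw [natDegree_X_mul hn.1.ne_zero, hn.2]
  have hrev := natDegree_reversed_le hn.2.le
  have hdeg : D.degree ≤ n := by
    refine (degree_add_le _ _).trans (max_le ?_ ?_)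
    · refine Order.le_of_lt_succ ?_
      have : (monicOP μ (n + 1) - X * monicOP μ n).degree < (monicOP μ (n + 1)).degree :=
        degree_sub_lt_left (by rw [degree_eq_natDegree hn1.1.ne_zero, hn1.2, degree_eq_natDegree
          (monic_X.mul hn.1).ne_zero, hXd]) hn1.1.ne_zero
          (by rw [hn1.1.leadingCoeff, (monic_X.mul hn.1).leadingCoeff])
      rw [degree_eq_natDegree hn1.1.ne_zero, hn1.2] at this
      exact_mod_cast this
    · exact (degree_C_mul_le' _ _).trans (degree_le_of_natDegree_le hrev)
  have h0 : D.eval 0 = 0 := by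
    simp [hD, reversed_eval_zero, ha']
  obtain ⟨E, hE⟩ : X ∣ D := by
    rw [X_dvd_iff, coeff_zero_eq_eval_zero, h0]
  by_cases hE0 : E = 0
  · rw [hE, hE0, mul_zero]
  have hEn : E.natDegree + 1 ≤ n := by
    have := natDegree_le_of_degree_le hdeg
    rwa [hE, natDegree_X_mul hE0] at this
  obtain ⟨m, rfl⟩ : ∃ m, n = m + 1 := ⟨n - 1, by omega⟩
  have hlt : ∀ Q : ℂ[X], Q.natDegree ≤ m → Q.degree < (m + 1 : ℕ) := fun Q hQ =>
    lt_of_le_of_lt (degree_le_of_natDegree_le hQ) (by exact_mod_cast Nat.lt_succ_self m)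
  apply eq_zero_of_ip_self hμ
  nth_rw 1 [hE]
  rw [hD, ip_add, ip_sub, ip_C_mul, ip_X_mul, ip_X_mul_reversed (by omega) hn.2.le,
    ip_monicOP_of_natDegree_lt hμ (m + 1) _ le_rfl
      (hlt _ (natDegree_reversed_le (by omega))),
    ← ip_conj (monicOP μ (m + 1)) E, ip_monicOP_of_natDegree_lt hμ (m + 1) E le_rfl
      (hlt _ (by omega)),
    ← ip_conj (monicOP μ (m + 1 + 1)) (X * E), ip_monicOP_of_natDegree_lt hμ (m + 1 + 1) (X * E)
      le_rfl]
  · simp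
  · rw [← hE]
    exact lt_of_le_of_lt hdeg (by exact_mod_cast Nat.lt_succ_self _)

/-- The Szegő recursion for the reversed polynomials. -/
theorem szego_recursion_reversed (hμ : IsNontrivial μ) (n : ℕ) :
    reversed (n + 1) (monicOP μ (n + 1)) =
      reversed n (monicOP μ n) - C (verblunsky μ n) * X * monicOP μ n := by
  have hn := (monicOP_aux (μ := μ) n).2
  have h1 : reversed (n + 1) (X * monicOP μ n) = reversed n (monicOP μ n) := by
    rw [reversed, Polynomial.map_mul, map_X, add_comm n 1,
      reflect_mul _ _ natDegree_X_le (by simp [hn]), reflect_one_X, one_mul, reversed]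
  have h2 : reversed (n + 1) (reversed n (monicOP μ n)) = X * monicOP μ n := by
    have hr := natDegree_reversed_le (n := n) hn.le
    have e : reversed n (monicOP μ n) = 1 * reversed n (monicOP μ n) := (one_mul _).symm
    rw [reversed, e, Polynomial.map_mul, add_comm n 1,
      reflect_mul _ _ (by simp) (by simpa using hr), Polynomial.map_one]
    congr 1
    · simp
    · ext k
      simp [reversed, coeff_reflect, revAt_invol]
  conv_lhs => rw [szego_recursion hμ n]
  rw [reversed] at h1 h2
  rw [reversed, Polynomial.map_sub, reflect_sub, h1, Polynomial.map_mul (f := starRingEnd ℂ)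
    (p := C _), map_C, reflect_C_mul, h2]
  simp [mul_assoc]

end

end OPUC

namespace OPUC

/-! Write `F`, `F₁` for the Carathéodory functions, `a = α₀`, and put `A = z(F+1) - ā(F-1)`, `B = F
- 1 - az(F+1)`. Two facts carry the proof.

Geronimus' theorem (`caratheodory_strip`): `B (F₁+1) = A (F₁-1)` on the disk, which is one step of
the Schur algorithm. Herglotz transforms of the orthogonal polynomials and of their conjugates
satisfy the Szegő recursion (`herglotz_monicOP_succ`, `herglotz_conj_monicOP_succ`). For `μ` the
recursion starts from `(F+1, F-1)` and reaches `(A, B)` after one step; for `μ₁` it starts from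
`(F₁+1, F₁-1)` and uses the same remaining coefficients. In both cases the second component after
`n` steps is divisible by a power of `z` growing with `n`, so the two starting vectors must be
proportional.

Boundary values (`ae_exists_tendsto_caratheodory_re_eq`): `F` has a radial limit almost everywhere,
and its real part is `w`. The real part is Fatou's theorem for Poisson integrals. Existence of the
full limit follows by applying Fatou to rotations of `√F`, whose values lie in a sector of
half-angle `π/4`.

The conclusion is then algebra on the circle (`boundary_identity`): `δ₀D = A / (zρ₀(F₁+1))`, `4 Re x
= |x+1|² - |x-1|²` and `|A|² - |B|² = ρ₀²(|F+1|² - |F-1|²)` for `|z| = 1`, so Geronimus' relation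
gives `|δ₀D|² Re F₁ = Re F`. -/

/-! ### Arc length, chords and normalized Lebesgue measure on the circle. -/

instance : IsProbabilityMeasure arc :=
  inferInstanceAs (IsProbabilityMeasure AddCircle.haarAddCircle)

lemma volume_eq_smul_arc :
    (volume : Measure UnitCircle) = ENNReal.ofReal (2 * Real.pi) • arc :=
  AddCircle.volume_eq_smul_haarAddCircle

/-- Doubling is insensitive to rescaling the measure. It provides the Vitali family used to
differentiate measures along arcs. -/
instance : IsUnifLocDoublingMeasure arc := by
  obtain ⟨C, hC⟩ := IsUnifLocDoublingMeasure.exists_measure_closedBall_le_mul''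
    (μ := (volume : Measure UnitCircle))
  refine ⟨C, hC.mono fun ε h x => ?_⟩
  have h0 : ENNReal.ofReal (2 * Real.pi) ≠ 0 := by
    simpa using Real.pi_pos
  have := h x
  rw [volume_eq_smul_arc] at this
  simp only [Measure.smul_apply, smul_eq_mul] at this
  rw [mul_left_comm] at this
  exact (ENNReal.mul_le_mul_iff_right h0 ENNReal.ofReal_ne_top).1 this

lemma norm_pt (θ : UnitCircle) : ‖pt θ‖ = 1 := Circle.norm_coe _

lemma pt_add (θ φ : UnitCircle) : pt (θ + φ) = pt θ * pt φ := by
  simp [pt, AddCircle.toCircle_add]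

lemma pt_coe (x : ℝ) : pt (x : UnitCircle) = Complex.exp (Complex.I * x) := by
  have : 2 * Real.pi / (2 * Real.pi) = 1 := div_self Real.two_pi_pos.ne'
  rw [pt, AddCircle.toCircle_apply_mk, this, one_mul, Circle.coe_exp, mul_comm]

/-- The chord between two points of the circle, in terms of the arc. -/
lemma norm_pt_sub_pt (φ θ : UnitCircle) : ‖pt φ - pt θ‖ = 2 * Real.sin (‖φ - θ‖ / 2) := by
  have h1 : ‖pt φ - pt θ‖ = ‖pt (φ - θ) - 1‖ := by
    have : pt φ - pt θ = (pt (φ - θ) - 1) * pt θ := by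
      rw [sub_mul, ← pt_add]; simp
    rw [this, norm_mul, norm_pt, mul_one]
  rw [h1]
  obtain ⟨x, hx, hx'⟩ : ∃ x : ℝ, (x : UnitCircle) = φ - θ ∧ |x| ≤ Real.pi := by
    refine ⟨AddCircle.equivIoc (2 * Real.pi) (-Real.pi) (φ - θ), AddCircle.coe_equivIoc, ?_⟩
    have := (AddCircle.equivIoc (2 * Real.pi) (-Real.pi) (φ - θ)).2
    rw [abs_le]
    constructor <;> linarith [this.1, this.2]
  have hn : ‖φ - θ‖ = |x| := by
    rw [← hx]
    refine (AddCircle.norm_coe_eq_abs_iff _ Real.two_pi_pos.ne').2 ?_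
    rw [abs_of_pos Real.two_pi_pos]
    linarith
  rw [← hx, pt_coe, Complex.norm_exp_I_mul_ofReal_sub_one, hx, hn, norm_mul, Real.norm_ofNat,
    Real.norm_eq_abs]
  congr 1
  rcases abs_cases x with ⟨h, h0⟩ | ⟨h, h0⟩
  · rw [h] at hx' ⊢
    exact abs_of_nonneg (Real.sin_nonneg_of_nonneg_of_le_pi (by linarith) (by linarith))
  · rw [h] at hx' ⊢
    rw [neg_div, Real.sin_neg]
    exact abs_of_nonpos (Real.sin_nonpos_of_nonpos_of_neg_pi_le (by linarith) (by linarith))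

/-- Chordal balls are balls for the arc length distance. -/
lemma setOf_chord_le (θ : UnitCircle) (c : ℝ) :
    {φ | ‖pt φ - pt θ‖ ≤ c} = Metric.closedBall θ (2 * Real.arcsin (c / 2)) := by
  ext φ
  have hb : ‖φ - θ‖ ≤ Real.pi := by
    have := AddCircle.norm_le_half_period _ (x := φ - θ) Real.two_pi_pos.ne'
    rw [abs_of_pos Real.two_pi_pos] at this
    linarith
  -- No bound on `c` is needed because `arcsin` is clamped: `c ≥ 2` gives radius `π`, the whole
  -- circle, and `c < 0` gives a negative radius, the empty ball.
  have := Real.le_arcsin_iff_sin_le' (x := ‖φ - θ‖ / 2) (y := c / 2)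
    ⟨by linarith [norm_nonneg (φ - θ), Real.pi_pos], by linarith⟩
  rw [Set.mem_ofPred_eq, Metric.mem_closedBall, dist_eq_norm, norm_pt_sub_pt]
  constructor
  · intro h
    linarith [this.2 (by linarith)]
  · intro h
    linarith [this.1 (by linarith)]

lemma integral_arc_eq_circleAverage {E : Type*} [NormedAddCommGroup E] [NormedSpace ℝ E]
    (g : ℂ → E) : ∫ θ, g (pt θ) ∂arc = Real.circleAverage g 0 1 := by
  rw [arc, AddCircle.integral_haarAddCircle, Real.circleAverage_def,
    ← AddCircle.intervalIntegral_preimage (2 * Real.pi) 0, zero_add]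
  simp [pt_coe, circleMap, mul_comm]

/-! ### Differentiation of measures and Fatou's theorem for Poisson integrals. -/

/-- Lebesgue differentiation of a measure on the circle along centered arcs. -/
lemma ae_tendsto_closedBall_div (ν : Measure UnitCircle) [IsFiniteMeasure ν] :
    ∀ᵐ θ ∂arc, Tendsto (fun s => ν.real (Metric.closedBall θ s) / arc.real (Metric.closedBall θ s))
      (𝓝[>] 0) (𝓝 (ν.rnDeriv arc θ).toReal) := by
  filter_upwards [(IsUnifLocDoublingMeasure.vitaliFamily arc 1).ae_tendsto_rnDeriv ν,
    ν.rnDeriv_lt_top arc] with θ h ht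
  have h1 := h.comp (IsUnifLocDoublingMeasure.tendsto_closedBall_filterAt arc (K := 1) (x := θ)
    (l := 𝓝[>] (0 : ℝ)) (fun _ => θ) id tendsto_id (by
      filter_upwards [self_mem_nhdsWithin] with s hs
      simpa using (Set.mem_Ioi.1 hs).le))
  have h2 := (ENNReal.tendsto_toReal ht.ne).comp h1
  refine h2.congr fun s => ?_
  simp [Measure.real, ENNReal.toReal_div]

/-- A layer cake comparison of the integrals of a bounded function against two measures. -/
lemma abs_integral_sub_le_of_superlevel {X : Type*} [MeasurableSpace X] {ν m : Measure X}
    [IsFiniteMeasure ν] [IsFiniteMeasure m] {f : X → ℝ} {K M D ε : ℝ} (hf : Measurable f)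
    (hf0 : ∀ x, 0 ≤ f x) (hfK : ∀ x, f x ≤ K) (hM : 0 ≤ M) (hD : 0 ≤ D) (hε : 0 ≤ ε)
    (h : ∀ t, M < t → |ν.real {x | t ≤ f x} - D * m.real {x | t ≤ f x}| ≤
      ε * m.real {x | t ≤ f x}) :
    |∫ x, f x ∂ν - D * ∫ x, f x ∂m| ≤
      ε * ∫ x, f x ∂m + M * (ν.real Set.univ + D * m.real Set.univ) := by
  -- An upper bound for `f` that is also at least `M`, so that the level integral can be split at
  -- `M`.
  set C := max K M with hC
  have hMC : M ≤ C := le_max_right _ _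
  have hCf : ∀ x, f x ≤ C := fun x => (hfK x).trans (le_max_left _ _)
  have key : ∀ ρ : Measure X, IsFiniteMeasure ρ →
      ∫ x, f x ∂ρ = ∫ t in (0 : ℝ)..C, ρ.real {x | t ≤ f x} := by
    intro ρ _
    rw [intervalIntegral.integral_of_le (hM.trans hMC)]
    refine Integrable.integral_eq_integral_Ioc_meas_le ?_ (ae_of_all _ hf0) (ae_of_all _ hCf)
    refine Integrable.of_bound hf.aestronglyMeasurable C (ae_of_all _ fun x => ?_)
    rw [Real.norm_of_nonneg (hf0 x)]
    exact hCf x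
  have anti : ∀ ρ : Measure X, IsFiniteMeasure ρ → Antitone fun t => ρ.real {x | t ≤ f x} :=
    fun ρ _ s t hst => measureReal_mono fun x (hx : t ≤ f x) => hst.trans hx
  have ii : ∀ ρ : Measure X, IsFiniteMeasure ρ → ∀ a b : ℝ,
      IntervalIntegrable (fun t => ρ.real {x | t ≤ f x}) volume a b :=
    fun ρ hρ a b => (anti ρ hρ).intervalIntegrable
  have id : ∀ a b : ℝ, IntervalIntegrable
      (fun t => ν.real {x | t ≤ f x} - D * m.real {x | t ≤ f x}) volume a b := fun a b =>
    (ii ν inferInstance a b).sub ((ii m inferInstance a b).const_mul D)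
  -- Levels above `M` are compared through `h`; levels below `M` are estimated by the total masses
  -- alone.
  have e : ∫ x, f x ∂ν - D * ∫ x, f x ∂m =
      (∫ t in (0 : ℝ)..M, (ν.real {x | t ≤ f x} - D * m.real {x | t ≤ f x})) +
      ∫ t in M..C, (ν.real {x | t ≤ f x} - D * m.real {x | t ≤ f x}) := by
    rw [intervalIntegral.integral_add_adjacent_intervals (id _ _) (id _ _),
      intervalIntegral.integral_sub (ii _ inferInstance _ _)
        ((ii _ inferInstance _ _).const_mul D), intervalIntegral.integral_const_mul,
      ← key ν inferInstance, ← key m inferInstance]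
  have b1 : |∫ t in (0 : ℝ)..M, (ν.real {x | t ≤ f x} - D * m.real {x | t ≤ f x})| ≤
      M * (ν.real Set.univ + D * m.real Set.univ) := by
    have := intervalIntegral.norm_integral_le_of_norm_le_const (a := (0 : ℝ)) (b := M)
      (f := fun t => ν.real {x | t ≤ f x} - D * m.real {x | t ≤ f x})
      (C := ν.real Set.univ + D * m.real Set.univ) (fun t _ => by
        have h1 : ν.real {x | t ≤ f x} ≤ ν.real Set.univ := measureReal_mono (Set.subset_univ _)
        have h2 : m.real {x | t ≤ f x} ≤ m.real Set.univ := measureReal_mono (Set.subset_univ _)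
        have h3 : 0 ≤ ν.real {x | t ≤ f x} := measureReal_nonneg
        have h4 : 0 ≤ m.real {x | t ≤ f x} := measureReal_nonneg
        have h5 := mul_le_mul_of_nonneg_left h2 hD
        have h6 := mul_nonneg hD h4
        rw [Real.norm_eq_abs, abs_le]
        constructor <;> linarith)
    rw [sub_zero, abs_of_nonneg hM, Real.norm_eq_abs] at this
    linarith
  have b2 : |∫ t in M..C, (ν.real {x | t ≤ f x} - D * m.real {x | t ≤ f x})| ≤
      ε * ∫ x, f x ∂m := by
    have h1 := intervalIntegral.norm_integral_le_of_norm_le hMC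
      (f := fun t => ν.real {x | t ≤ f x} - D * m.real {x | t ≤ f x})
      (g := fun t => ε * m.real {x | t ≤ f x}) (ae_of_all _ fun t ht => h t ht.1)
      ((ii m inferInstance _ _).const_mul ε)
    rw [Real.norm_eq_abs, intervalIntegral.integral_const_mul] at h1
    refine h1.trans (mul_le_mul_of_nonneg_left ?_ hε)
    rw [key m inferInstance, ← intervalIntegral.integral_add_adjacent_intervals
      (ii m inferInstance 0 M) (ii m inferInstance M C)]
    have : 0 ≤ ∫ t in (0 : ℝ)..M, m.real {x | t ≤ f x} :=
      intervalIntegral.integral_nonneg hM fun _ _ => measureReal_nonneg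
    linarith
  rw [e]
  exact (abs_add_le _ _).trans (by linarith)

/-- Written this way the Poisson kernel is, for `0 < r < 1`, a decreasing function of the chord, so
its superlevel sets are chordal balls about `θ`, the sets on which the symmetric derivative gives
information. -/
lemma re_herglotz_eq (r : ℝ) (φ θ : UnitCircle) :
    ((pt φ + r * pt θ) / (pt φ - r * pt θ)).re =
      (1 - r ^ 2) / ((1 - r) ^ 2 + r * ‖pt φ - pt θ‖ ^ 2) := by
  have h := congrFun (poissonKernel_eq_re_herglotzRieszKernel (c := 0) (w := r * pt θ)) (pt φ)
  simp only [Function.comp_apply, herglotzRieszKernel_def, poissonKernel_def, sub_zero] at h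
  rw [← h, norm_mul, norm_pt, norm_pt]
  have h1 : (pt φ).re ^ 2 + (pt φ).im ^ 2 = 1 := by
    have := Complex.sq_norm (pt φ)
    rw [norm_pt, Complex.normSq_apply] at this
    linarith
  have h2 : (pt θ).re ^ 2 + (pt θ).im ^ 2 = 1 := by
    have := Complex.sq_norm (pt θ)
    rw [norm_pt, Complex.normSq_apply] at this
    linarith
  have h3 : ‖pt φ - r * pt θ‖ ^ 2 = (1 - r) ^ 2 + r * ‖pt φ - pt θ‖ ^ 2 := by
    simp only [Complex.sq_norm, Complex.normSq_apply, Complex.sub_re, Complex.sub_im,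
      Complex.mul_re, Complex.mul_im, Complex.ofReal_re, Complex.ofReal_im]
    linear_combination (1 - r) * h1 + (r ^ 2 - r) * h2
  rw [h3]
  simp

lemma continuous_herglotz {z : ℂ} (hz : ‖z‖ < 1) :
    Continuous fun φ => (pt φ + z) / (pt φ - z) := by
  refine (continuous_pt.add continuous_const).div (continuous_pt.sub continuous_const) ?_
  intro φ h
  rw [sub_eq_zero] at h
  rw [← h, norm_pt] at hz
  exact lt_irrefl _ hz

lemma norm_mul_pt {r : ℝ} (hr0 : 0 ≤ r) (θ : UnitCircle) : ‖(r : ℂ) * pt θ‖ = r := by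
  simp [norm_pt, abs_of_nonneg hr0]

lemma integral_re_herglotz_arc {z : ℂ} (hz : ‖z‖ < 1) :
    ∫ φ, ((pt φ + z) / (pt φ - z)).re ∂arc = 1 := by
  have h := DiffContOnCl.circleAverage_re_herglotzRieszKernel_smul' (f := fun _ => (1 : ℂ))
    (c := 0) (R := 1) (w := z) diffContOnCl_const (by simpa using hz)
  rw [← integral_arc_eq_circleAverage] at h
  simp only [sub_zero, Complex.real_smul, mul_one] at h
  rw [integral_complex_ofReal] at h
  exact_mod_cast h

lemma arc_real_closedBall_pos (θ : UnitCircle) {s : ℝ} (hs : 0 < s) :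
    0 < arc.real (Metric.closedBall θ s) := by
  have h := AddCircle.volume_closedBall (2 * Real.pi) (x := θ) s
  rw [volume_eq_smul_arc, Measure.smul_apply, smul_eq_mul] at h
  refine ENNReal.toReal_pos (fun h0 => ?_) (measure_ne_top _ _)
  rw [h0, mul_zero, eq_comm, ENNReal.ofReal_eq_zero] at h
  have : 0 < min (2 * Real.pi) (2 * s) := lt_min Real.two_pi_pos (by linarith)
  linarith

lemma tendsto_arc_real_closedBall (θ : UnitCircle) :
    Tendsto (fun s => arc.real (Metric.closedBall θ s)) (𝓝[>] 0) (𝓝 0) := by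
  have h : ∀ s, 2 * Real.pi * arc.real (Metric.closedBall θ s) =
      (ENNReal.ofReal (min (2 * Real.pi) (2 * s))).toReal := fun s => by
    rw [← AddCircle.volume_closedBall (2 * Real.pi) (x := θ) s, volume_eq_smul_arc,
      Measure.smul_apply, smul_eq_mul, ENNReal.toReal_mul,
      ENNReal.toReal_ofReal Real.two_pi_pos.le, Measure.real]
  refine squeeze_zero' (Eventually.of_forall fun s => measureReal_nonneg)
    (g := fun s => (2 * s) / (2 * Real.pi)) ?_ ?_
  · filter_upwards [self_mem_nhdsWithin] with s hs
    rw [le_div_iff₀ Real.two_pi_pos, mul_comm, h s]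
    have hs' : (0 : ℝ) < s := hs
    rw [ENNReal.toReal_ofReal (le_min Real.two_pi_pos.le (by linarith))]
    exact min_le_right _ _
  · have : Tendsto (fun s : ℝ => (2 * s) / (2 * Real.pi)) (𝓝 0) (𝓝 ((2 * 0) / (2 * Real.pi))) :=
      (continuous_const.mul continuous_id).div_const _ |>.tendsto 0
    simp only [mul_zero, zero_div] at this
    exact this.mono_left nhdsWithin_le_nhds

/-- If `ν` has symmetric derivative `D` at `θ`, it is uniformly close to `D` times arc length
on small chordal balls. -/
lemma exists_chord_close {ν : Measure UnitCircle} [IsFiniteMeasure ν] {θ : UnitCircle} {D : ℝ}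
    (h : Tendsto (fun s => ν.real (Metric.closedBall θ s) / arc.real (Metric.closedBall θ s))
      (𝓝[>] 0) (𝓝 D)) {ε : ℝ} (hε : 0 < ε) :
    ∃ η > 0, ∀ c ≤ η, |ν.real {φ | ‖pt φ - pt θ‖ ≤ c} - D * arc.real {φ | ‖pt φ - pt θ‖ ≤ c}| ≤
      ε * arc.real {φ | ‖pt φ - pt θ‖ ≤ c} := by
  have h1 : ∀ᶠ s in 𝓝[>] (0 : ℝ), |ν.real (Metric.closedBall θ s) -
      D * arc.real (Metric.closedBall θ s)| ≤ ε * arc.real (Metric.closedBall θ s) := by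
    filter_upwards [Metric.tendsto_nhds.1 h ε hε, self_mem_nhdsWithin] with s hs hs0
    have hp := arc_real_closedBall_pos θ (Set.mem_Ioi.1 hs0)
    rw [Real.dist_eq, div_sub' hp.ne', abs_div, abs_of_pos hp, div_lt_iff₀ hp] at hs
    rw [mul_comm D]
    exact hs.le
  -- The limit only speaks of positive radii. At radius `0`, convergence of the quotient together
  -- with `arc`-masses tending to `0` excludes an atom of `ν` at `θ`.
  have h0 : ν.real (Metric.closedBall θ 0) = 0 ∧ arc.real (Metric.closedBall θ 0) = 0 := by
    have ha := tendsto_arc_real_closedBall θ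
    have mono : ∀ (ρ : Measure UnitCircle) [IsFiniteMeasure ρ], ∀ᶠ s in 𝓝[>] (0 : ℝ),
        ρ.real (Metric.closedBall θ 0) ≤ ρ.real (Metric.closedBall θ s) := fun ρ _ => by
      filter_upwards [self_mem_nhdsWithin] with s hs
      exact measureReal_mono (Metric.closedBall_subset_closedBall (Set.mem_Ioi.1 hs).le)
    have hn : Tendsto (fun s => ν.real (Metric.closedBall θ s)) (𝓝[>] 0) (𝓝 0) := by
      have := h.mul ha
      rw [mul_zero] at this
      refine this.congr' ?_
      filter_upwards [self_mem_nhdsWithin] with s hs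
      exact div_mul_cancel₀ _ (arc_real_closedBall_pos θ (Set.mem_Ioi.1 hs)).ne'
    exact ⟨le_antisymm (ge_of_tendsto hn (mono ν)) measureReal_nonneg,
      le_antisymm (ge_of_tendsto ha (mono arc)) measureReal_nonneg⟩
  obtain ⟨δ, hδ, hδ'⟩ := mem_nhdsGT_iff_exists_Ioc_subset.1 h1
  have hδ0 : (0 : ℝ) < δ := hδ
  -- The cap at `π` keeps `δ₁ / 2` where `arcsin` inverts `sin`; the required `η` is the chord of an
  -- arc of length `δ₁`.
  set δ₁ := min δ Real.pi with hδ₁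
  have hδ₁0 : 0 < δ₁ := lt_min hδ0 Real.pi_pos
  refine ⟨2 * Real.sin (δ₁ / 2), mul_pos two_pos (Real.sin_pos_of_pos_of_lt_pi (by linarith)
    (by linarith [min_le_right δ Real.pi, Real.pi_pos])), fun c hc => ?_⟩
  rw [setOf_chord_le]
  have hle : 2 * Real.arcsin (c / 2) ≤ δ := by
    have : Real.arcsin (c / 2) ≤ Real.arcsin (Real.sin (δ₁ / 2)) :=
      Real.monotone_arcsin (by linarith)
    rw [Real.arcsin_sin (by linarith [Real.pi_pos]) (by linarith [min_le_right δ Real.pi])] at this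
    linarith [min_le_left δ Real.pi]
  rcases lt_trichotomy (2 * Real.arcsin (c / 2)) 0 with hs | hs | hs
  · simp [Metric.closedBall_eq_empty.2 hs]
  · rw [hs, h0.1, h0.2]
    simp
  · exact hδ' ⟨hs, hle⟩

/-- **Fatou's theorem** at a point where the symmetric derivative exists. -/
theorem tendsto_poisson_of_tendsto_closedBall_div {ν : Measure UnitCircle} [IsFiniteMeasure ν]
    {θ : UnitCircle} {D : ℝ}
    (h : Tendsto (fun s => ν.real (Metric.closedBall θ s) / arc.real (Metric.closedBall θ s))
      (𝓝[>] 0) (𝓝 D)) :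
    Tendsto (fun r : ℝ => ∫ φ, ((pt φ + r * pt θ) / (pt φ - r * pt θ)).re ∂ν) (𝓝[<] 1) (𝓝 D) := by
  have hD : 0 ≤ D := ge_of_tendsto h (Eventually.of_forall fun s =>
    div_nonneg measureReal_nonneg measureReal_nonneg)
  rw [Metric.tendsto_nhds]
  intro ε hε
  obtain ⟨η, hη, hc⟩ := exists_chord_close h (half_pos hε)
  have hlim : Tendsto (fun r : ℝ => (1 - r ^ 2) / ((1 - r) ^ 2 + r * η ^ 2) *
      (ν.real Set.univ + D * arc.real Set.univ)) (𝓝[<] 1) (𝓝 0) := by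
    have hc : ContinuousAt (fun r : ℝ => (1 - r ^ 2) / ((1 - r) ^ 2 + r * η ^ 2) *
      (ν.real Set.univ + D * arc.real Set.univ)) 1 := by
      refine ContinuousAt.mul (ContinuousAt.div (by fun_prop) (by fun_prop) ?_)
        continuousAt_const
      simp [hη.ne']
    have := hc.tendsto
    simp only [one_pow, sub_self, zero_div, zero_mul] at this
    exact this.mono_left nhdsWithin_le_nhds
  filter_upwards [Metric.tendsto_nhds.1 hlim _ (half_pos hε),
    Ioo_mem_nhdsLT (zero_lt_one (α := ℝ))] with r hr hr01
  obtain ⟨hr0, hr1⟩ := hr01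
  have hz : ‖(r : ℂ) * pt θ‖ < 1 := by rwa [norm_mul_pt hr0.le]
  have hcont := Complex.continuous_re.comp (continuous_herglotz hz)
  have hI := integral_re_herglotz_arc hz
  have hnum : 0 < 1 - r ^ 2 := by nlinarith
  have hden : ∀ x : ℝ, 0 < (1 - r) ^ 2 + r * x ^ 2 := fun x => by
    have : 0 < (1 - r) ^ 2 := pow_pos (by linarith) 2
    positivity
  -- The value of the Poisson kernel at chord `η`. It tends to `0` as `r → 1`, so the contribution
  -- of levels below `M` disappears.
  set M := (1 - r ^ 2) / ((1 - r) ^ 2 + r * η ^ 2) with hM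
  have hM0 : 0 < M := div_pos hnum (hden _)
  have hs : ∀ t, M < t →
      |ν.real {φ | t ≤ ((pt φ + r * pt θ) / (pt φ - r * pt θ)).re} -
        D * arc.real {φ | t ≤ ((pt φ + r * pt θ) / (pt φ - r * pt θ)).re}| ≤
      ε / 2 * arc.real {φ | t ≤ ((pt φ + r * pt θ) / (pt φ - r * pt θ)).re} := by
    intro t ht
    have ht0 : 0 < t := hM0.trans ht
    -- Obtained by solving `t = kernel` for the squared chord. It is negative when `t` exceeds the
    -- maximum of the kernel.
    set q := ((1 - r ^ 2) / t - (1 - r) ^ 2) / r with hq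
    have hiff : ∀ φ, t ≤ ((pt φ + r * pt θ) / (pt φ - r * pt θ)).re ↔
        ‖pt φ - pt θ‖ ^ 2 ≤ q := fun φ => by
      rw [re_herglotz_eq, le_div_iff₀ (hden _), hq, le_div_iff₀ hr0,
        le_sub_iff_add_le (c := (1 - r ^ 2) / t) (b := (1 - r) ^ 2),
        le_div_iff₀ ht0]
      constructor <;> intro h' <;> linarith
    have hqη : q < η ^ 2 := by
      rw [hq, div_lt_iff₀ hr0, sub_lt_iff_lt_add, div_lt_iff₀ ht0]
      rw [hM, div_lt_iff₀ (hden _)] at ht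
      linarith
    simp only [hiff]
    rcases lt_or_ge q 0 with hq0 | hq0
    · have : {φ | ‖pt φ - pt θ‖ ^ 2 ≤ q} = ∅ := by
        ext φ
        simp only [Set.mem_ofPred_eq, Set.mem_empty_iff_false, iff_false, not_le]
        exact hq0.trans_le (sq_nonneg _)
      simp [this]
    · have : {φ | ‖pt φ - pt θ‖ ^ 2 ≤ q} = {φ | ‖pt φ - pt θ‖ ≤ √q} := by
        ext φ
        exact (Real.le_sqrt (norm_nonneg _) hq0).symm
      rw [this]
      refine hc _ ?_
      rw [Real.sqrt_le_left hη.le]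
      exact hqη.le
  have hfin := abs_integral_sub_le_of_superlevel (ν := ν) (m := arc)
    (f := fun φ => ((pt φ + r * pt θ) / (pt φ - r * pt θ)).re)
    (K := (1 - r ^ 2) / (1 - r) ^ 2) hcont.measurable
    (fun φ => by rw [re_herglotz_eq]; exact (div_pos hnum (hden _)).le)
    (fun φ => by
      rw [re_herglotz_eq]
      refine div_le_div_of_nonneg_left hnum.le (pow_pos (by linarith) 2) ?_
      have := mul_nonneg hr0.le (sq_nonneg ‖pt φ - pt θ‖)
      linarith) hM0.le hD (half_pos hε).le hs
  rw [hI, mul_one, mul_one] at hfin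
  rw [Real.dist_eq]
  rw [Real.dist_eq, sub_zero] at hr
  linarith [le_abs_self (M * (ν.real Set.univ + D * arc.real Set.univ))]

/-- **Fatou's theorem** for Poisson integrals of finite measures on the circle. -/
theorem ae_tendsto_poisson (ν : Measure UnitCircle) [IsFiniteMeasure ν] :
    ∀ᵐ θ ∂arc, Tendsto (fun r : ℝ => ∫ φ, ((pt φ + r * pt θ) / (pt φ - r * pt θ)).re ∂ν)
      (𝓝[<] 1) (𝓝 (ν.rnDeriv arc θ).toReal) := by
  filter_upwards [ae_tendsto_closedBall_div ν] with θ h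
  exact tendsto_poisson_of_tendsto_closedBall_div h

/-! ### Herglotz integrals and Carathéodory functions inside the disk. -/

lemma continuous_herglotz_mul {z : ℂ} (hz : ‖z‖ < 1) {g : UnitCircle → ℂ} (hg : Continuous g) :
    Continuous fun φ => (pt φ + z) / (pt φ - z) * g φ := (continuous_herglotz hz).mul hg

lemma integrable_of_continuous {μ : Measure UnitCircle} [IsFiniteMeasure μ] {E : Type*}
    [NormedAddCommGroup E] {g : UnitCircle → E} (hg : Continuous g) : Integrable g μ :=
  hg.integrable_of_hasCompactSupport (HasCompactSupport.of_compactSpace _)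

/-- Herglotz transforms of continuous densities are holomorphic in the disk. -/
lemma differentiableOn_herglotz_integral {μ : Measure UnitCircle} [IsFiniteMeasure μ]
    {g : UnitCircle → ℂ} (hg : Continuous g) :
    DifferentiableOn ℂ (fun z => ∫ φ, (pt φ + z) / (pt φ - z) * g φ ∂μ) (Metric.ball 0 1) := by
  intro z₀ hz₀
  have hz₀' : ‖z₀‖ < 1 := by simpa using hz₀
  -- Half the distance from `z₀` to the circle: every point within `d` of `z₀` stays at distance at
  -- least `d` from the circle.
  set d := (1 - ‖z₀‖) / 2 with hd
  have hd0 : 0 < d := by rw [hd]; linarith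
  have hfar : ∀ z ∈ Metric.ball z₀ d, ∀ φ, d ≤ ‖pt φ - z‖ := by
    intro z hz φ
    have h1 : ‖z - z₀‖ < d := by simpa [dist_eq_norm] using hz
    have h2 : ‖pt φ‖ ≤ ‖pt φ - z‖ + ‖z - z₀‖ + ‖z₀‖ := by
      calc ‖pt φ‖ = ‖(pt φ - z) + (z - z₀) + z₀‖ := by congr 1; ring
        _ ≤ _ := norm_add₃_le
    rw [norm_pt] at h2
    linarith
  have hne : ∀ z ∈ Metric.ball z₀ d, ∀ φ, pt φ - z ≠ 0 := fun z hz φ h => by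
    have := hfar z hz φ
    rw [h, norm_zero] at this
    linarith
  obtain ⟨C, hC⟩ := isCompact_univ.exists_bound_of_continuousOn (f := g) hg.continuousOn
  have hC' : ∀ φ, ‖g φ‖ ≤ C := fun φ => hC φ trivial
  refine DifferentiableAt.differentiableWithinAt ?_
  refine (hasDerivAt_integral_of_dominated_loc_of_deriv_le (Metric.ball_mem_nhds z₀ hd0)
    (F' := fun z φ => 2 * pt φ / (pt φ - z) ^ 2 * g φ) (bound := fun _ => 2 / d ^ 2 * C)
    ?_ (integrable_of_continuous (continuous_herglotz_mul hz₀' hg)) ?_ ?_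
    (integrable_const _) ?_).2.differentiableAt
  · filter_upwards [Metric.isOpen_ball.mem_nhds hz₀] with z hz
    exact (continuous_herglotz_mul (by simpa using hz) hg).aestronglyMeasurable
  · refine Continuous.aestronglyMeasurable (Continuous.mul (Continuous.div ?_ ?_ ?_) hg)
    · exact continuous_const.mul continuous_pt
    · exact (continuous_pt.sub continuous_const).pow 2
    · exact fun φ => pow_ne_zero 2 (hne z₀ (Metric.mem_ball_self hd0) φ)
  · refine ae_of_all _ fun φ z hz => ?_
    rw [norm_mul, norm_div, norm_mul, norm_pow, norm_pt, mul_one, Complex.norm_ofNat]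
    have := hfar z hz φ
    gcongr
    exact hC' φ
  · refine ae_of_all _ fun φ z hz => ?_
    have h := (((hasDerivAt_id' z).const_add (pt φ)).div ((hasDerivAt_id' z).const_sub (pt φ))
      (hne z hz φ)).mul_const (g φ)
    exact h.congr_deriv (by congr 2; ring)

lemma differentiableOn_caratheodory (μ : Measure UnitCircle) [IsFiniteMeasure μ] :
    DifferentiableOn ℂ (caratheodory μ) (Metric.ball 0 1) := by
  have := differentiableOn_herglotz_integral (μ := μ) (g := fun _ => 1) continuous_const
  simp only [mul_one] at this
  exact this

lemma re_caratheodory (μ : Measure UnitCircle) [IsFiniteMeasure μ] {z : ℂ} (hz : ‖z‖ < 1) :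
    (caratheodory μ z).re = ∫ φ, ((pt φ + z) / (pt φ - z)).re ∂μ :=
  (integral_re (integrable_of_continuous (continuous_herglotz hz))).symm

lemma caratheodory_zero (μ : Measure UnitCircle) [IsProbabilityMeasure μ] :
    caratheodory μ 0 = 1 := by
  have : ∀ θ, pt θ ≠ 0 := fun θ h => by simpa [h] using norm_pt θ
  simp [caratheodory, this]

/-- Harnack's lower bound `(1 - |z|) / (1 + |z|)` for the Poisson kernel survives integration and
gives strict positivity. -/
lemma re_caratheodory_pos (μ : Measure UnitCircle) [IsProbabilityMeasure μ] {z : ℂ}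
    (hz : ‖z‖ < 1) : 0 < (caratheodory μ z).re := by
  have hpos : 0 < (1 - ‖z‖) / (1 + ‖z‖) := div_pos (by linarith) (by positivity)
  refine hpos.trans_le ?_
  rw [re_caratheodory μ hz]
  have h : ∫ φ, (1 - ‖z‖) / (1 + ‖z‖) ∂μ ≤ ∫ φ, ((pt φ + z) / (pt φ - z)).re ∂μ := by
    refine integral_mono (integrable_const _) (integrable_of_continuous
      (Complex.continuous_re.comp (continuous_herglotz hz))) fun φ => ?_
    have := le_re_herglotzRieszKernel (c := 0) (R := 1) (w := z) (z := pt φ)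
      (by simp [norm_pt]) (by simpa using hz)
    simpa using this
  simpa using h

/-! ### Herglotz representation and radial limits. -/

/-- **Herglotz representation**: a holomorphic function of nonnegative real part on the disk,
of real part `1` at the origin, has as real part the Poisson integral of a probability measure. -/
theorem exists_measure_re_eq_poisson {H : ℂ → ℂ} (hH : DifferentiableOn ℂ H (Metric.ball 0 1))
    (hre : ∀ z ∈ Metric.ball (0 : ℂ) 1, 0 ≤ (H z).re) (h0 : (H 0).re = 1) :
    ∃ ν : ProbabilityMeasure UnitCircle, ∀ z ∈ Metric.ball (0 : ℂ) 1,
      (H z).re = ∫ φ, ((pt φ + z) / (pt φ - z)).re ∂(ν : Measure UnitCircle) := by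
  have hmem : ∀ r ∈ Set.Ioo (0 : ℝ) 1, ∀ z : ℂ, ‖z‖ ≤ 1 → (r : ℂ) * z ∈ Metric.ball (0 : ℂ) 1 := by
    intro r hr z hz
    rw [mem_ball_zero_iff, norm_mul, Complex.norm_real, Real.norm_of_nonneg hr.1.le]
    nlinarith [hr.1, hr.2, norm_nonneg z]
  have hcont : ∀ r ∈ Set.Ioo (0 : ℝ) 1, Continuous fun φ => (H (r * pt φ)).re := fun r hr =>
    Complex.continuous_re.comp (hH.continuousOn.comp_continuous
      (continuous_const.mul continuous_pt) fun φ => hmem r hr _ (norm_pt φ).le)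
  have hpoisson : ∀ r ∈ Set.Ioo (0 : ℝ) 1, ∀ z ∈ Metric.ball (0 : ℂ) 1,
      ∫ φ, (H (r * pt φ)).re * ((pt φ + z) / (pt φ - z)).re ∂arc = (H (r * z)).re := by
    intro r hr z hz
    have hd : DiffContOnCl ℂ (fun z => H (r * z)) (Metric.ball 0 1) := by
      refine DifferentiableOn.diffContOnCl ?_
      rw [closure_ball _ one_ne_zero]
      exact hH.comp (differentiableOn_id.const_mul _) fun z hz =>
        hmem r hr z (by simpa using hz)
    have h := hd.circleAverage_re_herglotzRieszKernel_smul' hz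
    rw [← integral_arc_eq_circleAverage] at h
    rw [← h]
    have hi : Integrable (fun φ => (((pt φ - 0 + (z - 0)) / (pt φ - 0 - (z - 0))).re •
        H (r * pt φ) : ℂ)) arc := by
      refine integrable_of_continuous ?_
      simp only [sub_zero]
      exact (Complex.continuous_re.comp (continuous_herglotz (by simpa using hz))).smul
        (hH.continuousOn.comp_continuous (continuous_const.mul continuous_pt)
          fun φ => hmem r hr _ (norm_pt φ).le)
    refine Eq.trans ?_ (integral_re hi)
    refine integral_congr_ae (ae_of_all _ fun φ => ?_)
    simp [mul_comm]
  have hmeasure : ∀ r ∈ Set.Ioo (0 : ℝ) 1, ∃ ν : ProbabilityMeasure UnitCircle,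
      ∀ z ∈ Metric.ball (0 : ℂ) 1,
      ∫ φ, ((pt φ + z) / (pt φ - z)).re ∂(ν : Measure UnitCircle) = (H (r * z)).re := by
    intro r hr
    have hnn : ∀ φ, 0 ≤ (H (r * pt φ)).re := fun φ => hre _ (hmem r hr _ (norm_pt φ).le)
    have hm : Measurable fun φ => ENNReal.ofReal (H (r * pt φ)).re :=
      (hcont r hr).measurable.ennreal_ofReal
    refine ⟨⟨arc.withDensity fun φ => ENNReal.ofReal (H (r * pt φ)).re, ⟨?_⟩⟩, fun z hz => ?_⟩
    · rw [withDensity_apply _ MeasurableSet.univ, setLIntegral_univ,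
        ← ofReal_integral_eq_lintegral_ofReal (integrable_of_continuous (hcont r hr))
          (ae_of_all _ hnn)]
      -- At the origin the Poisson kernel is `1`, so the total mass is `Re H(0) = 1`.
      have := hpoisson r hr 0 (by simp)
      have hne : ∀ θ, pt θ ≠ 0 := fun θ h => by simpa [h] using norm_pt θ
      simp only [add_zero, sub_zero, div_self (hne _), Complex.one_re, mul_one, mul_zero, h0]
        at this
      rw [this, ENNReal.ofReal_one]
    · rw [← hpoisson r hr z hz]
      refine (integral_withDensity_eq_integral_toReal_smul hm
        (ae_of_all _ fun _ => ENNReal.ofReal_lt_top) _).trans ?_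
      refine integral_congr_ae (ae_of_all _ fun φ => ?_)
      simp [ENNReal.toReal_ofReal (hnn φ)]
  choose! ν hν using hmeasure
  -- Weak compactness of probability measures on the circle: along an ultrafilter finer than `r ↑ 1`
  -- the dilated measures converge, with no subsequence to extract.
  set l := Ultrafilter.of (𝓝[<] (1 : ℝ))
  have hle : (l : Filter ℝ) ≤ 𝓝[<] 1 := Ultrafilter.of_le _
  have hlim : Tendsto ν l (𝓝 (l.map ν).lim) := (l.map ν).le_nhds_lim
  refine ⟨(l.map ν).lim, fun z hz => ?_⟩
  have hz' : ‖z‖ < 1 := by simpa using hz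
  have h1 := (ProbabilityMeasure.tendsto_iff_forall_integral_tendsto.1 hlim)
    (BoundedContinuousFunction.mkOfCompact
      ⟨fun φ => ((pt φ + z) / (pt φ - z)).re,
        Complex.continuous_re.comp (continuous_herglotz hz')⟩)
  have h2 : Tendsto (fun r : ℝ => (H (r * z)).re) l (𝓝 (H z).re) := by
    have hc : ContinuousAt (fun r : ℝ => (H (r * z)).re) 1 := by
      have hHc : ContinuousAt H z :=
        hH.continuousOn.continuousAt (Metric.isOpen_ball.mem_nhds hz)
      have : ContinuousAt H (((1 : ℝ) : ℂ) * z) := by simpa using hHc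
      exact Complex.continuous_re.continuousAt.comp
        (this.comp (f := fun r : ℝ => (r : ℂ) * z)
          (Complex.continuous_ofReal.mul continuous_const).continuousAt)
    have := hc.tendsto
    simp only [Complex.ofReal_one, one_mul] at this
    exact this.mono_left (hle.trans nhdsWithin_le_nhds)
  refine tendsto_nhds_unique h2 (h1.congr' ?_)
  filter_upwards [hle (Ioo_mem_nhdsLT (zero_lt_one (α := ℝ)))] with r hr
  exact hν r hr z hz

/-- A holomorphic function whose values lie in the sector `|Im| ≤ Re` has radial limits almost
everywhere, being determined by the positive real parts of its two rotations by `± π / 4`. -/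
lemma ae_exists_tendsto_of_abs_im_le_re {G : ℂ → ℂ} (hG : DifferentiableOn ℂ G (Metric.ball 0 1))
    (hs : ∀ z ∈ Metric.ball (0 : ℂ) 1, |(G z).im| ≤ (G z).re) (h0 : G 0 = 1) :
    ∀ᵐ θ ∂arc, ∃ L : ℂ, Tendsto (fun r : ℝ => G (r * pt θ)) (𝓝[<] 1) (𝓝 L) := by
  obtain ⟨ν₁, hν₁⟩ := exists_measure_re_eq_poisson (H := fun z => (1 + Complex.I) * G z)
    (hG.const_mul _) (fun z hz => by
      have := abs_le.1 (hs z hz)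
      simp only [Complex.mul_re, Complex.add_re, Complex.one_re, Complex.I_re, Complex.add_im,
        Complex.one_im, Complex.I_im]
      linarith) (by simp [h0])
  obtain ⟨ν₂, hν₂⟩ := exists_measure_re_eq_poisson (H := fun z => (1 - Complex.I) * G z)
    (hG.const_mul _) (fun z hz => by
      have := abs_le.1 (hs z hz)
      simp only [Complex.mul_re, Complex.sub_re, Complex.one_re, Complex.I_re, Complex.sub_im,
        Complex.one_im, Complex.I_im]
      linarith) (by simp [h0])
  filter_upwards [ae_tendsto_poisson ν₁, ae_tendsto_poisson ν₂] with θ h₁ h₂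
  -- The two Poisson integrals are `Re G - Im G` and `Re G + Im G`; their half-sum and
  -- half-difference recover `G`.
  refine ⟨_, Tendsto.congr' ?_ (((Complex.continuous_ofReal.tendsto _).comp
    ((h₁.add h₂).div_const 2)).add (((Complex.continuous_ofReal.tendsto _).comp
    ((h₂.sub h₁).div_const 2)).mul_const Complex.I))⟩
  filter_upwards [Ioo_mem_nhdsLT (zero_lt_one (α := ℝ))] with r hr
  have hz : (r : ℂ) * pt θ ∈ Metric.ball (0 : ℂ) 1 := by
    rw [mem_ball_zero_iff, norm_mul_pt hr.1.le]
    exact hr.2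
  simp only [Function.comp_apply]
  rw [← hν₁ _ hz, ← hν₂ _ hz]
  apply Complex.ext <;> simp

/-- The Carathéodory function has radial limits almost everywhere. -/
theorem ae_exists_tendsto_caratheodory (μ : Measure UnitCircle) [IsProbabilityMeasure μ] :
    ∀ᵐ θ ∂arc, ∃ L : ℂ,
      Tendsto (fun r : ℝ => caratheodory μ (r * pt θ)) (𝓝[<] 1) (𝓝 L) := by
  have hsq : ∀ x : ℂ, (x ^ (2⁻¹ : ℂ)) ^ 2 = x := fun x => by
    simp
  have hpos : ∀ z ∈ Metric.ball (0 : ℂ) 1, 0 < (caratheodory μ z).re := fun z hz =>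
    re_caratheodory_pos μ (by simpa using hz)
  -- Fatou applied to `F` itself controls only its real part. The principal square root takes values
  -- in the sector `|Im| ≤ Re`, because `(Re s)² - (Im s)² = Re (s²) > 0`.
  have h := ae_exists_tendsto_of_abs_im_le_re (G := fun z => caratheodory μ z ^ (2⁻¹ : ℂ))
    (fun z hz => (differentiableOn_caratheodory μ z hz).cpow (differentiableWithinAt_const _)
      (Or.inl (hpos z hz)))
    (fun z hz => by
      have h1 := hsq (caratheodory μ z)
      have h2 : 0 ≤ (caratheodory μ z ^ (2⁻¹ : ℂ)).re := by
        rw [Complex.cpow_inv_two_re]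
        exact Real.sqrt_nonneg _
      refine abs_le_of_sq_le_sq ?_ h2
      have h3 := hpos z hz
      rw [← h1, pow_two, Complex.mul_re] at h3
      nlinarith)
    (by simp [caratheodory_zero])
  filter_upwards [h] with θ hθ
  obtain ⟨L, hL⟩ := hθ
  exact ⟨L ^ 2, (hL.pow 2).congr fun r => hsq _⟩

/-- The radial limits of the Carathéodory function exist almost everywhere and have as real part
the weight of the measure. -/
theorem ae_exists_tendsto_caratheodory_re_eq {μ : Measure UnitCircle} [IsProbabilityMeasure μ]
    {w : UnitCircle → ℝ} (hw : IsACWeight μ w) :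
    ∀ᵐ θ ∂arc, ∃ L : ℂ, L.re = w θ ∧
      Tendsto (fun r : ℝ => caratheodory μ (r * pt θ)) (𝓝[<] 1) (𝓝 L) := by
  obtain ⟨hwm, hw0, μs, hs, he⟩ := hw
  -- Uniqueness of the Lebesgue decomposition identifies `w` with the derivative in Fatou's theorem.
  have hd := Measure.eq_rnDeriv₀ hwm.ennreal_ofReal hs (he.trans (add_comm _ _))
  filter_upwards [ae_exists_tendsto_caratheodory μ, ae_tendsto_poisson μ, hd, hw0]
    with θ ⟨L, hL⟩ hp hdθ h0
  refine ⟨L, ?_, hL⟩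
  rw [← hdθ, ENNReal.toReal_ofReal h0] at hp
  refine tendsto_nhds_unique ((Complex.continuous_re.tendsto L).comp hL) (hp.congr' ?_)
  filter_upwards [Ioo_mem_nhdsLT (zero_lt_one (α := ℝ))] with r hr
  exact (re_caratheodory μ (by rw [norm_mul_pt hr.1.le]; exact hr.2)).symm

-- The Szegő recursion for Herglotz transforms.

local notation "conj" => starRingEnd ℂ

/-- The Herglotz transform of the complex measure `g dμ`. -/
noncomputable def herglotz (μ : Measure UnitCircle) (g : UnitCircle → ℂ) (z : ℂ) : ℂ :=
  ∫ θ, (pt θ + z) / (pt θ - z) * g θ ∂μ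

lemma caratheodory_eq_herglotz (μ : Measure UnitCircle) (z : ℂ) :
    caratheodory μ z = herglotz μ (fun _ => 1) z := by
  simp [caratheodory, herglotz]

lemma continuous_eval_pt (P : ℂ[X]) : Continuous fun θ => P.eval (pt θ) :=
  P.continuous.comp continuous_pt

lemma continuous_conj_eval_pt (P : ℂ[X]) : Continuous fun θ => conj (P.eval (pt θ)) :=
  Complex.continuous_conj.comp (continuous_eval_pt P)

lemma monicOP_zero (μ : Measure UnitCircle) : monicOP μ 0 = 1 := by
  rw [monicOP]; simp

section orthogonality

variable {μ : Measure UnitCircle} [IsFiniteMeasure μ]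

lemma ip_one_monicOP (hμ : IsNontrivial μ) (n : ℕ) : ip μ 1 (monicOP μ (n + 1)) = 0 := by
  have := ip_monicOP_lt hμ (n + 1) 0 n.succ_pos
  rwa [monicOP_zero] at this

lemma monicOP_eval_succ (hμ : IsNontrivial μ) (n : ℕ) (θ : UnitCircle) :
    (monicOP μ (n + 1)).eval (pt θ) = pt θ * (monicOP μ n).eval (pt θ) -
      conj (verblunsky μ n) * (pt θ ^ n * conj ((monicOP μ n).eval (pt θ))) := by
  rw [szego_recursion hμ n]
  simp only [eval_sub, eval_mul, eval_X, eval_C]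
  rw [reversed_eval n (monicOP_aux n).2.le]

/-- Pair the Szegő recursion with `1`: the left side vanishes by orthogonality, and `⟨1, Φ_n^*⟩ =
⟨Φ_n, z^n⟩` on the circle. -/
lemma ip_one_X_mul_monicOP (hμ : IsNontrivial μ) (n : ℕ) :
    ip μ 1 (X * monicOP μ n) = conj (verblunsky μ n) * ip μ (monicOP μ n) (X ^ n) := by
  have h := ip_one_monicOP hμ n
  rw [szego_recursion hμ n, ip_sub, ip_C_mul, sub_eq_zero] at h
  rw [h]
  congr 1
  unfold ip
  congr 1
  ext θ
  rw [reversed_eval n (monicOP_aux n).2.le]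
  simp [mul_comm]

lemma ip_monicOP_add_of_degree_lt (hμ : IsNontrivial μ) {n : ℕ} (P : ℂ[X]) {R : ℂ[X]}
    (hR : R.degree < n) : ip μ (monicOP μ n) (P + R) = ip μ (monicOP μ n) P := by
  rw [ip_add, ip_monicOP_of_natDegree_lt hμ n R le_rfl hR, add_zero]

end orthogonality

lemma degree_sum_lt {n : ℕ} (c : ℕ → ℂ) :
    (∑ i ∈ Finset.range n, C (c i) * X ^ i : ℂ[X]).degree < (n : WithBot ℕ) := by
  rw [← mem_degreeLT]
  refine Submodule.sum_mem _ fun i hi => ?_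
  rw [mem_degreeLT]
  exact (degree_C_mul_X_pow_le _ _).trans_lt (by exact_mod_cast Finset.mem_range.1 hi)

/-- `(x + z) (x^n - z^n) / (x - z)` as a polynomial in `x`. -/
noncomputable def kernelPoly (n : ℕ) (z : ℂ) : ℂ[X] :=
  (X + C z) * ∑ i ∈ Finset.range n, C (z ^ (n - 1 - i)) * X ^ i

/-- `(1 + c x) (1 - (c x)^n) / (1 - c x)` as a polynomial in `x`. -/
noncomputable def dualKernelPoly (n : ℕ) (c : ℂ) : ℂ[X] :=
  (1 + C c * X) * ∑ i ∈ Finset.range n, C (c ^ i) * X ^ i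

lemma kernelPoly_eval_mul (n : ℕ) (z x : ℂ) :
    (kernelPoly n z).eval x * (x - z) = (x + z) * (x ^ n - z ^ n) := by
  rw [kernelPoly, ← geom_sum₂_mul x z n]
  simp only [eval_mul, eval_add, eval_X, eval_C, eval_finsetSum, eval_pow]
  rw [mul_assoc]
  congr 2
  exact Finset.sum_congr rfl fun i _ => mul_comm _ _

lemma dualKernelPoly_eval_mul (n : ℕ) (c x : ℂ) :
    (dualKernelPoly n c).eval x * (1 - c * x) = (1 + c * x) * (1 - (c * x) ^ n) := by
  rw [dualKernelPoly]
  simp only [eval_mul, eval_add, eval_X, eval_C, eval_finsetSum, eval_pow, eval_one]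
  have := geom_sum_mul (c * x) n
  simp only [mul_pow] at this ⊢
  linear_combination -(1 + c * x) * this

section

variable {μ : Measure UnitCircle} [IsFiniteMeasure μ]

/-- Since `x + z = (x - z) + 2z`, the polynomial is `x^n` plus terms of degree below `n`, which
`Φ_n` does not see. For `n = 0` it is `0` instead of `1`, so the first step of the recursion is
treated separately. -/
lemma ip_monicOP_kernelPoly (hμ : IsNontrivial μ) {n : ℕ} (hn : n ≠ 0) (z : ℂ) :
    ip μ (monicOP μ n) (kernelPoly n z) = ip μ (monicOP μ n) (X ^ n) := by
  set S : ℂ[X] := ∑ i ∈ Finset.range n, C (z ^ (n - 1 - i)) * X ^ i with hS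
  have h : S * (X - C z) = X ^ n - C (z ^ n) := by
    rw [C_pow, ← geom_sum₂_mul]
    congr 1
    exact Finset.sum_congr rfl fun i _ => by rw [C_pow, mul_comm]
  have e : kernelPoly n z = X ^ n + (C (2 * z) * S - C (z ^ n)) := by
    rw [kernelPoly, C_mul, show (C 2 : ℂ[X]) = 2 from rfl]
    linear_combination h
  rw [e]
  refine ip_monicOP_add_of_degree_lt hμ _ ?_
  refine (degree_sub_le _ _).trans_lt (max_lt ?_ ?_)
  · exact (degree_C_mul_le' _ _).trans_lt (degree_sum_lt _)
  · exact degree_C_le.trans_lt (by exact_mod_cast Nat.pos_of_ne_zero hn)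

lemma ip_monicOP_dualKernelPoly (hμ : IsNontrivial μ) {n : ℕ} (hn : n ≠ 0) (c : ℂ) :
    ip μ (monicOP μ n) (dualKernelPoly n c) = c ^ n * ip μ (monicOP μ n) (X ^ n) := by
  set S : ℂ[X] := ∑ i ∈ Finset.range n, C (c ^ i) * X ^ i with hS
  have h : S * (C c * X - 1) = C (c ^ n) * X ^ n - 1 := by
    rw [C_pow, ← mul_pow, ← geom_sum_mul]
    congr 1
    exact Finset.sum_congr rfl fun i _ => by rw [C_pow, mul_pow]
  have e : dualKernelPoly n c = C (c ^ n) * X ^ n + (C 2 * S - C 1) := by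
    rw [dualKernelPoly, show (C 2 : ℂ[X]) = 2 from rfl, C_1]
    linear_combination h
  rw [e, ip_monicOP_add_of_degree_lt hμ, ip_C_mul]
  refine (degree_sub_le _ _).trans_lt (max_lt ?_ ?_)
  · exact (degree_C_mul_le' _ _).trans_lt (degree_sum_lt _)
  · exact degree_C_le.trans_lt (by exact_mod_cast Nat.pos_of_ne_zero hn)

/-- One step of the Szegő recursion for Herglotz transforms, up to moments. -/
lemma herglotz_monicOP_succ_aux (hμ : IsNontrivial μ) (n : ℕ) {z : ℂ} (hz : ‖z‖ < 1) :
    herglotz μ (fun θ => (monicOP μ (n + 1)).eval (pt θ)) z =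
      z * herglotz μ (fun θ => (monicOP μ n).eval (pt θ)) z -
      conj (verblunsky μ n) *
        (z ^ n * herglotz μ (fun θ => conj ((monicOP μ n).eval (pt θ))) z) +
      (ip μ 1 (X * monicOP μ n) + z * ip μ 1 (monicOP μ n) -
        conj (verblunsky μ n) * ip μ (monicOP μ n) (kernelPoly n z)) := by
  have hne : ∀ θ, pt θ - z ≠ 0 := fun θ h => by
    rw [sub_eq_zero] at h
    rw [← h, norm_pt] at hz
    exact lt_irrefl _ hz
  have i1 := integrable_of_continuous (μ := μ)
    (continuous_herglotz_mul hz (continuous_eval_pt (monicOP μ n)))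
  have i2 := integrable_of_continuous (μ := μ)
    (continuous_herglotz_mul hz (continuous_conj_eval_pt (monicOP μ n)))
  rw [← ip_C_mul, ← ip_C_mul, ← ip_add]
  unfold herglotz ip
  simp only [← integral_const_mul]
  rw [← integral_sub (i1.const_mul _) ((i2.const_mul _).const_mul _),
    ← integral_sub (integrable_ip _ _) (integrable_ip _ _),
    ← integral_add]
  rotate_left
  · exact (i1.const_mul _).sub ((i2.const_mul _).const_mul _)
  · exact (integrable_ip _ _).sub (integrable_ip _ _)
  refine integral_congr_ae (ae_of_all _ fun θ => ?_)
  have hk := kernelPoly_eval_mul n z (pt θ)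
  simp only [monicOP_eval_succ hμ, eval_one, map_one, eval_mul, eval_X, eval_add, eval_C]
  have h := hne θ
  field_simp
  linear_combination (conj (verblunsky μ n)) * conj ((monicOP μ n).eval (pt θ)) * hk

/-- One step of the Szegő recursion for dual Herglotz transforms, up to moments. -/
lemma herglotz_conj_monicOP_succ_aux (hμ : IsNontrivial μ) (n : ℕ) {z : ℂ} (hz : ‖z‖ < 1) :
    z ^ (n + 1) * herglotz μ (fun θ => conj ((monicOP μ (n + 1)).eval (pt θ))) z =
      z ^ n * herglotz μ (fun θ => conj ((monicOP μ n).eval (pt θ))) z -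
      verblunsky μ n * (z * herglotz μ (fun θ => (monicOP μ n).eval (pt θ)) z) -
      (z ^ n * (ip μ (monicOP μ n) 1 + z * ip μ (X * monicOP μ n) 1) -
        verblunsky μ n * (z * ip μ (dualKernelPoly n (conj z)) (monicOP μ n))) := by
  have hne : ∀ θ, pt θ - z ≠ 0 := fun θ h => by
    rw [sub_eq_zero] at h
    rw [← h, norm_pt] at hz
    exact lt_irrefl _ hz
  have i1 := integrable_of_continuous (μ := μ)
    (continuous_herglotz_mul hz (continuous_eval_pt (monicOP μ n)))
  have i2 := integrable_of_continuous (μ := μ)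
    (continuous_herglotz_mul hz (continuous_conj_eval_pt (monicOP μ n)))
  have e1 : ip μ (monicOP μ n) 1 + z * ip μ (X * monicOP μ n) 1 =
      ip μ (monicOP μ n + C (conj z) * (X * monicOP μ n)) 1 := by
    rw [← ip_conj 1 (monicOP μ n + _), ip_add, ip_C_mul, map_add, map_mul, ip_conj, ip_conj,
      Complex.conj_conj]
  rw [e1]
  unfold herglotz ip
  simp only [← integral_const_mul]
  rw [← integral_sub (i2.const_mul _) ((i1.const_mul _).const_mul _),
    ← integral_sub ((integrable_ip _ _).const_mul _)
      (((integrable_ip _ _).const_mul _).const_mul _),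
    ← integral_sub]
  rotate_left
  · exact (i2.const_mul _).sub ((i1.const_mul _).const_mul _)
  · exact ((integrable_ip _ _).const_mul _).sub (((integrable_ip _ _).const_mul _).const_mul _)
  refine integral_congr_ae (ae_of_all _ fun θ => ?_)
  have hk := congrArg conj (dualKernelPoly_eval_mul n (conj z) (pt θ))
  have he := pt_mul_conj θ
  simp only [map_mul, map_sub, map_add, map_one, map_pow, Complex.conj_conj, mul_pow] at hk
  simp only [monicOP_eval_succ hμ, eval_one, map_sub, map_mul, map_pow, Complex.conj_conj]
  have h0 : pt θ ≠ 0 := left_ne_zero_of_mul_eq_one he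
  have hsub : pt θ - z = pt θ * (1 - z * conj (pt θ)) := by linear_combination z * he
  have h1 : 1 - z * conj (pt θ) ≠ 0 := fun h => hne θ (by rw [hsub, h, mul_zero])
  -- In terms of `u = z e^{-iθ}` the kernel `K` satisfies `K u = K - (1 + u)`, and `K (1 - u^n)` is
  -- the conjugate of the dual kernel polynomial.
  have hK : (pt θ + z) / (pt θ - z) = (1 + z * conj (pt θ)) / (1 - z * conj (pt θ)) := by
    rw [hsub, div_eq_div_iff (mul_ne_zero h0 h1) h1]
    linear_combination -z * (1 - z * conj (pt θ)) * he
  rw [hK]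
  simp only [eval_add, eval_mul, eval_C, eval_X, map_add, map_mul, Complex.conj_conj]
  field_simp
  linear_combination -(verblunsky μ n * z * (monicOP μ n).eval (pt θ)) * hk

/-- The Szegő recursion for Herglotz transforms of orthogonal polynomials. -/
lemma herglotz_monicOP_succ (hμ : IsNontrivial μ) {n : ℕ} (hn : n ≠ 0) {z : ℂ} (hz : ‖z‖ < 1) :
    herglotz μ (fun θ => (monicOP μ (n + 1)).eval (pt θ)) z =
      z * herglotz μ (fun θ => (monicOP μ n).eval (pt θ)) z -
      conj (verblunsky μ n) *
        (z ^ n * herglotz μ (fun θ => conj ((monicOP μ n).eval (pt θ))) z) := by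
  obtain ⟨m, rfl⟩ : ∃ m, n = m + 1 := ⟨n - 1, by omega⟩
  -- For `n ≥ 1` the moment terms cancel: `⟨1, Φ_n⟩ = 0`, and the other two both equal `conj(α_n)
  -- ⟨Φ_n, z^n⟩`.
  rw [herglotz_monicOP_succ_aux hμ _ hz, ip_one_monicOP hμ, ip_monicOP_kernelPoly hμ hn,
    ip_one_X_mul_monicOP hμ]
  ring

/-- The Szegő recursion for dual Herglotz transforms of orthogonal polynomials. -/
lemma herglotz_conj_monicOP_succ (hμ : IsNontrivial μ) {n : ℕ} (hn : n ≠ 0) {z : ℂ}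
    (hz : ‖z‖ < 1) :
    z ^ (n + 1) * herglotz μ (fun θ => conj ((monicOP μ (n + 1)).eval (pt θ))) z =
      z ^ n * herglotz μ (fun θ => conj ((monicOP μ n).eval (pt θ))) z -
      verblunsky μ n * (z * herglotz μ (fun θ => (monicOP μ n).eval (pt θ)) z) := by
  obtain ⟨m, rfl⟩ : ∃ m, n = m + 1 := ⟨n - 1, by omega⟩
  rw [herglotz_conj_monicOP_succ_aux hμ _ hz, ← ip_conj 1, ip_one_monicOP hμ,
    ← ip_conj 1 (X * _), ip_one_X_mul_monicOP hμ, ← ip_conj (monicOP μ (m + 1)),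
    ip_monicOP_dualKernelPoly hμ hn]
  simp only [map_mul, map_pow, map_zero, Complex.conj_conj]
  ring

end

section

variable {μ : Measure UnitCircle} [IsProbabilityMeasure μ]

lemma ip_one_one : ip μ 1 1 = 1 := by simp [ip]

lemma ip_one_X (hμ : IsNontrivial μ) : ip μ 1 X = conj (verblunsky μ 0) := by
  have := ip_one_X_mul_monicOP hμ 0
  simpa [monicOP_zero, ip_one_one] using this

/-- At degree zero the moments do not cancel. They shift `F` to `F ± 1`, so that the first step is
the recursion applied to `(F + 1, F - 1)`. -/
lemma herglotz_monicOP_one (hμ : IsNontrivial μ) {z : ℂ} (hz : ‖z‖ < 1) :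
    herglotz μ (fun θ => (monicOP μ 1).eval (pt θ)) z =
      z * (caratheodory μ z + 1) - conj (verblunsky μ 0) * (caratheodory μ z - 1) := by
  have h := herglotz_monicOP_succ_aux hμ 0 hz
  simp only [monicOP_zero, eval_one, map_one, mul_one, ip_one_X hμ, ip_one_one, kernelPoly,
    Finset.range_zero, Finset.sum_empty, mul_zero, ip_zero, pow_zero, one_mul,
    ← caratheodory_eq_herglotz, zero_add] at h
  rw [h]
  ring

lemma herglotz_conj_monicOP_one (hμ : IsNontrivial μ) {z : ℂ} (hz : ‖z‖ < 1) :
    z * herglotz μ (fun θ => conj ((monicOP μ 1).eval (pt θ))) z =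
      caratheodory μ z - 1 - verblunsky μ 0 * (z * (caratheodory μ z + 1)) := by
  have h := herglotz_conj_monicOP_succ_aux hμ 0 hz
  have hX : ip μ X 1 = verblunsky μ 0 := by
    rw [← ip_conj 1 X, ip_one_X hμ, Complex.conj_conj]
  have h0 : ip μ 0 1 = 0 := by simp [ip]
  simp only [monicOP_zero, eval_one, map_one, mul_one, hX, ip_one_one, dualKernelPoly,
    Finset.range_zero, Finset.sum_empty, mul_zero, pow_zero, one_mul,
    ← caratheodory_eq_herglotz, zero_add, pow_one, h0] at h
  rw [h]
  ring

/-- The squared norm of `Φ₁` is `1 - |α₀|²`, and it is positive because `μ` is nontrivial. -/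
lemma norm_verblunsky_zero_lt_one (hμ : IsNontrivial μ) : ‖verblunsky μ 0‖ < 1 := by
  set a := verblunsky μ 0 with ha
  have h1 : monicOP μ 1 = X - C (conj a) * 1 := by
    rw [szego_recursion hμ 0, monicOP_zero]
    simp [reversed, ha]
  have h2 : ip μ (monicOP μ 1) (monicOP μ 1) = 1 - a * conj a := by
    nth_rw 2 [h1]
    rw [ip_sub, ip_C_mul, ← ip_conj 1 (monicOP μ 1), ip_one_monicOP hμ 0,
      ← ip_conj X, h1, ip_sub, ip_C_mul, ← ip_conj 1 X, ip_one_X hμ]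
    have : ip μ X X = 1 := by
      have := ip_X_mul (μ := μ) 1 1
      rwa [mul_one, ip_one_one] at this
    simp [this, ← ha, mul_comm]
  have h3 : 0 ≤ (ip μ (monicOP μ 1) (monicOP μ 1)).re := by
    rw [ip, ← RCLike.re_eq_complex_re, ← integral_re (integrable_ip _ _)]
    refine integral_nonneg fun θ => ?_
    rw [mul_comm, Complex.mul_conj]
    simp [Complex.normSq_nonneg]
  have h4 : ip μ (monicOP μ 1) (monicOP μ 1) ≠ 0 := fun h =>
    (monicOP_aux 1).1.ne_zero (eq_zero_of_ip_self hμ h)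
  rw [h2, Complex.mul_conj, Complex.normSq_eq_norm_sq] at h3 h4
  have h5 : 0 ≤ 1 - ‖a‖ ^ 2 := by
    simpa [← Complex.ofReal_pow] using h3
  have h6 : 1 - ‖a‖ ^ 2 ≠ 0 := fun h => h4 (by exact_mod_cast congrArg ((↑) : ℝ → ℂ) h)
  have h7 : 0 < 1 - ‖a‖ ^ 2 := lt_of_le_of_ne h5 h6.symm
  nlinarith [norm_nonneg a]

end

/-! ### Transfer maps and Geronimus' theorem. -/

/-- The transfer map of the Szegő recursion with coefficients `a 0, …, a (n - 1)`. -/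
noncomputable def transfer (a : ℕ → ℂ) (z : ℂ) : ℕ → ℂ × ℂ → ℂ × ℂ
  | 0, v => v
  | n + 1, v => (z * (transfer a z n v).1 - conj (a n) * (transfer a z n v).2,
      (transfer a z n v).2 - a n * (z * (transfer a z n v).1))

lemma transfer_eq (a : ℕ → ℂ) (z : ℂ) (n : ℕ) (v : ℂ × ℂ) :
    transfer a z n v = v.1 • transfer a z n (1, 0) + v.2 • transfer a z n (0, 1) := by
  induction n with
  | zero => ext <;> simp [transfer]
  | succ n ih =>
    have h1 := congrArg Prod.fst ih
    have h2 := congrArg Prod.snd ih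
    simp only [Prod.fst_add, Prod.smul_fst, Prod.snd_add, Prod.smul_snd, smul_eq_mul] at h1 h2
    ext
    · simp only [transfer, h1, h2, Prod.fst_add, Prod.smul_fst, smul_eq_mul]
      ring
    · simp only [transfer, h1, h2, Prod.snd_add, Prod.smul_snd, smul_eq_mul]
      ring

lemma transfer_zero_snd (a : ℕ → ℂ) (n : ℕ) (v : ℂ × ℂ) : (transfer a 0 n v).2 = v.2 := by
  induction n with
  | zero => rfl
  | succ n ih => simp [transfer, ih]

lemma continuous_transfer (a : ℕ → ℂ) (n : ℕ) (v : ℂ × ℂ) :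
    Continuous fun z => transfer a z n v := by
  induction n with
  | zero => exact continuous_const
  | succ n ih =>
    simp only [transfer]
    fun_prop

/-- The Herglotz transforms attached to orthogonal polynomials of `μ` are transferred by the
Szegő recursion, starting from those of degree one. -/
lemma transfer_herglotz_monicOP_one {μ : Measure UnitCircle} [IsProbabilityMeasure μ]
    (hμ : IsNontrivial μ) {a : ℕ → ℂ} (ha : ∀ n, a n = verblunsky μ (n + 1)) {z : ℂ}
    (hz : ‖z‖ < 1) (n : ℕ) :
    transfer a z n (z * (caratheodory μ z + 1) - conj (verblunsky μ 0) * (caratheodory μ z - 1),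
        caratheodory μ z - 1 - verblunsky μ 0 * (z * (caratheodory μ z + 1))) =
      (herglotz μ (fun θ => (monicOP μ (n + 1)).eval (pt θ)) z,
        z ^ (n + 1) * herglotz μ (fun θ => conj ((monicOP μ (n + 1)).eval (pt θ))) z) := by
  induction n with
  | zero =>
    rw [transfer, herglotz_monicOP_one hμ hz, zero_add, pow_one, herglotz_conj_monicOP_one hμ hz]
  | succ n ih =>
    rw [transfer, ih, herglotz_monicOP_succ hμ n.succ_ne_zero hz,
      herglotz_conj_monicOP_succ hμ n.succ_ne_zero hz, ha]

/-- The count starts at `n + 1` because `(F + 1, F - 1)` is not itself the pair of Herglotz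
transforms of `Φ₀ = 1`; agreement begins at degree one. -/
lemma transfer_caratheodory {μ : Measure UnitCircle} [IsProbabilityMeasure μ]
    (hμ : IsNontrivial μ) {z : ℂ} (hz : ‖z‖ < 1) (n : ℕ) :
    transfer (verblunsky μ) z (n + 1) (caratheodory μ z + 1, caratheodory μ z - 1) =
      (herglotz μ (fun θ => (monicOP μ (n + 1)).eval (pt θ)) z,
        z ^ (n + 1) * herglotz μ (fun θ => conj ((monicOP μ (n + 1)).eval (pt θ))) z) := by
  induction n with
  | zero =>
    rw [transfer, transfer, zero_add, herglotz_monicOP_one hμ hz, pow_one,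
      herglotz_conj_monicOP_one hμ hz]
  | succ n ih =>
    rw [transfer, ih, herglotz_monicOP_succ hμ n.succ_ne_zero hz,
      herglotz_conj_monicOP_succ hμ n.succ_ne_zero hz]

/-- An analytic function which, up to factors nonvanishing at `0`, is divisible by every power of
the variable vanishes near `0`. -/
lemma eventually_eq_zero_of_forall_pow_dvd {E : ℂ → ℂ} (hE : AnalyticAt ℂ E 0)
    (h : ∀ n : ℕ, ∃ q g : ℂ → ℂ, ContinuousAt q 0 ∧ q 0 ≠ 0 ∧ ContinuousAt g 0 ∧
      ∀ᶠ z in 𝓝 0, q z * E z = z ^ (n + 1) * g z) :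
    ∀ᶠ z in 𝓝 0, E z = 0 := by
  by_contra hne
  -- If `E` vanishes to exact order `n`, divisibility by `z^(n+1)` already contradicts `q 0 * k 0 ≠
  -- 0`.
  obtain ⟨n, k, hk, hk0, hEk⟩ := hE.exists_eventuallyEq_pow_smul_nonzero_iff.2 hne
  obtain ⟨q, g, hq, hq0, hg, hqg⟩ := h n
  have h1 : ∀ᶠ z in 𝓝[≠] (0 : ℂ), q z * k z = z * g z := by
    filter_upwards [hEk.filter_mono nhdsWithin_le_nhds, hqg.filter_mono nhdsWithin_le_nhds,
      self_mem_nhdsWithin] with z h1 h2 hz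
    have hz' : z ≠ 0 := hz
    rw [h1, sub_zero, smul_eq_mul] at h2
    exact mul_left_cancel₀ (pow_ne_zero n hz') (by linear_combination h2)
  have h2 : Tendsto (fun z => q z * k z) (𝓝[≠] 0) (𝓝 (q 0 * k 0)) :=
    (hq.mul hk.continuousAt).tendsto.mono_left nhdsWithin_le_nhds
  have h3 : Tendsto (fun z => z * g z) (𝓝[≠] 0) (𝓝 (0 * g 0)) :=
    (continuousAt_id.mul hg).tendsto.mono_left nhdsWithin_le_nhds
  have := tendsto_nhds_unique h2 (h3.congr' (h1.mono fun _ h => h.symm))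
  rw [zero_mul] at this
  exact mul_ne_zero hq0 hk0 this

/-- **Geronimus' theorem**, one step: stripping off the first Verblunsky coefficient is one step of
the Schur algorithm, here in terms of Carathéodory functions. -/
theorem caratheodory_strip {μ μ₁ : Measure UnitCircle} [IsProbabilityMeasure μ]
    [IsProbabilityMeasure μ₁] (hμ : IsNontrivial μ) (hμ₁ : IsNontrivial μ₁)
    (hα : ∀ j : ℕ, verblunsky μ₁ j = verblunsky μ (j + 1)) {z : ℂ} (hz : ‖z‖ < 1) :
    (caratheodory μ z - 1 - verblunsky μ 0 * (z * (caratheodory μ z + 1))) *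
        (caratheodory μ₁ z + 1) =
      (z * (caratheodory μ z + 1) - conj (verblunsky μ 0) * (caratheodory μ z - 1)) *
        (caratheodory μ₁ z - 1) := by
  set E : ℂ → ℂ := fun z =>
    (caratheodory μ z - 1 - verblunsky μ 0 * (z * (caratheodory μ z + 1))) *
        (caratheodory μ₁ z + 1) -
      (z * (caratheodory μ z + 1) - conj (verblunsky μ 0) * (caratheodory μ z - 1)) *
        (caratheodory μ₁ z - 1) with hEdef
  have hF := differentiableOn_caratheodory μ
  have hF₁ := differentiableOn_caratheodory μ₁
  have hEan : AnalyticOnNhd ℂ E (Metric.ball 0 1) := by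
    refine DifferentiableOn.analyticOnNhd ?_ Metric.isOpen_ball
    fun_prop
  have hmem : (0 : ℂ) ∈ Metric.ball (0 : ℂ) 1 := by simp
  have hcont : ∀ {f : ℂ → ℂ}, DifferentiableOn ℂ f (Metric.ball 0 1) → ContinuousAt f 0 :=
    fun hf => hf.continuousOn.continuousAt (Metric.isOpen_ball.mem_nhds hmem)
  have hE0 : ∀ᶠ z in 𝓝 (0 : ℂ), E z = 0 := by
    refine eventually_eq_zero_of_forall_pow_dvd (hEan 0 hmem) fun n => ?_
    -- Expand the second components of both transferred vectors by linearity and eliminate the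
    -- coefficient of `(1, 0)`. What remains is `E` times the coefficient of `(0, 1)`, which equals
    -- `1` at `z = 0`. The extra `z` in the first term arises because the `μ` side has one more
    -- power.
    refine ⟨fun z => (transfer (verblunsky μ₁) z (n + 1) (0, 1)).2, fun z =>
      (caratheodory μ₁ z + 1) *
        (z * herglotz μ (fun θ => conj ((monicOP μ (n + 2)).eval (pt θ))) z) -
      (z * (caratheodory μ z + 1) - conj (verblunsky μ 0) * (caratheodory μ z - 1)) *
        herglotz μ₁ (fun θ => conj ((monicOP μ₁ (n + 1)).eval (pt θ))) z, ?_, ?_, ?_, ?_⟩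
    · exact (continuous_transfer _ _ _).snd.continuousAt
    · simp [transfer_zero_snd]
    · have h1 := hcont hF
      have h2 := hcont hF₁
      have h3 := hcont (differentiableOn_herglotz_integral (μ := μ)
        (continuous_conj_eval_pt (monicOP μ (n + 2))))
      have h4 := hcont (differentiableOn_herglotz_integral (μ := μ₁)
        (continuous_conj_eval_pt (monicOP μ₁ (n + 1))))
      unfold herglotz
      fun_prop
    · filter_upwards [Metric.isOpen_ball.mem_nhds hmem] with z hz
      have hz' : ‖z‖ < 1 := by simpa using hz
      have h1 := congrArg Prod.snd (transfer_herglotz_monicOP_one hμ hα hz' (n + 1))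
      have h2 := congrArg Prod.snd (transfer_caratheodory hμ₁ hz' n)
      rw [transfer_eq] at h1 h2
      simp only [Prod.snd_add, Prod.smul_snd, smul_eq_mul] at h1 h2
      simp only [hEdef]
      linear_combination (caratheodory μ₁ z + 1) * h1 -
        (z * (caratheodory μ z + 1) - conj (verblunsky μ 0) * (caratheodory μ z - 1)) * h2
  have := hEan.eqOn_zero_of_preconnected_of_eventuallyEq_zero
    (convex_ball (0 : ℂ) 1).isPreconnected hmem hE0
    (show z ∈ Metric.ball (0 : ℂ) 1 by simpa using hz)
  exact sub_eq_zero.1 this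

/-! ### Boundary values of the relative Szegő function. -/

lemma mul_schur {μ : Measure UnitCircle} [IsProbabilityMeasure μ] {z : ℂ} (hz : z ≠ 0) :
    z * schur μ z = (caratheodory μ z - 1) / (caratheodory μ z + 1) := by
  rw [schur, dslope_of_ne _ hz, slope_def_field, caratheodory_zero]
  simp only [sub_zero, sub_self, zero_div]
  exact mul_div_cancel₀ _ hz

/-- The boundary values of the relative Szegő function, in terms of those of `z f` and `z f₁`. -/
lemma boundary_identity {e a L L₁ : ℂ} (he : ‖e‖ = 1) (ha : ‖a‖ < 1) (hL : L + 1 ≠ 0)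
    (hL₁ : L₁ + 1 ≠ 0)
    (h : (L - 1 - a * (e * (L + 1))) * (L₁ + 1) = (e * (L + 1) - conj a * (L - 1)) * (L₁ - 1)) :
    ‖(1 - conj a * ((L - 1) / (L + 1) / e)) / (Real.sqrt (1 - ‖a‖ ^ 2) : ℂ) *
      ((L + 1) / (L₁ + 1))‖ ^ 2 * L₁.re = L.re := by
  have he0 : e ≠ 0 := fun h0 => by simp [h0] at he
  have hρ : 0 < 1 - ‖a‖ ^ 2 := by nlinarith [norm_nonneg a]
  have hρ0 : (Real.sqrt (1 - ‖a‖ ^ 2) : ℂ) ≠ 0 := by exact_mod_cast (Real.sqrt_pos.2 hρ).ne'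
  set N := e * (L + 1) - conj a * (L - 1) with hN
  have hd : (1 - conj a * ((L - 1) / (L + 1) / e)) / (Real.sqrt (1 - ‖a‖ ^ 2) : ℂ) *
      ((L + 1) / (L₁ + 1)) = N / (e * Real.sqrt (1 - ‖a‖ ^ 2) * (L₁ + 1)) := by
    rw [hN]
    field_simp
  have hdn : ‖N / (e * Real.sqrt (1 - ‖a‖ ^ 2) * (L₁ + 1))‖ ^ 2 =
      ‖N‖ ^ 2 / ((1 - ‖a‖ ^ 2) * ‖L₁ + 1‖ ^ 2) := by
    rw [norm_div, norm_mul, norm_mul, he, one_mul, div_pow, mul_pow, Complex.norm_real,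
      Real.norm_of_nonneg (Real.sqrt_nonneg _), Real.sq_sqrt hρ.le]
  have hre : ∀ x : ℂ, 4 * x.re = ‖x + 1‖ ^ 2 - ‖x - 1‖ ^ 2 := fun x => by
    simp only [Complex.sq_norm, Complex.normSq_apply, Complex.add_re, Complex.sub_re,
      Complex.add_im, Complex.sub_im, Complex.one_re, Complex.one_im]
    ring
  -- The Szegő step preserves the form `|x|² - |q|²` up to the factor `ρ₀²`.
  have hNM : ∀ x q : ℂ, ‖x - conj a * q‖ ^ 2 - ‖q - a * x‖ ^ 2 =
      (1 - ‖a‖ ^ 2) * (‖x‖ ^ 2 - ‖q‖ ^ 2) := fun x q => by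
    simp only [Complex.sq_norm, Complex.normSq_apply, Complex.sub_re, Complex.sub_im,
      Complex.mul_re, Complex.mul_im, Complex.conj_re, Complex.conj_im]
    ring
  have h1 := hNM (e * (L + 1)) (L - 1)
  rw [norm_mul, he, one_mul, ← hN, ← hre L] at h1
  have h2 := congrArg (fun x => ‖x‖ ^ 2) h
  simp only [norm_mul, mul_pow] at h2
  have hL₁' : ‖L₁ + 1‖ ≠ 0 := norm_ne_zero_iff.2 hL₁
  rw [hd, hdn, div_mul_eq_mul_div, div_eq_iff (by positivity)]
  linear_combination (1 / 4) * ‖N‖ ^ 2 * hre L₁ + (1 / 4) * ‖L₁ + 1‖ ^ 2 * h1 + (1 / 4) * h2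

/-- Almost everywhere, the relative Szegő function has a radial limit `d`, and `|d|² w₁ = w`. -/
theorem ae_exists_tendsto_relativeSzego {μ μ₁ : Measure UnitCircle} [IsProbabilityMeasure μ]
    [IsProbabilityMeasure μ₁] (hμ : IsNontrivial μ) (hμ₁ : IsNontrivial μ₁)
    (hα : ∀ j : ℕ, verblunsky μ₁ j = verblunsky μ (j + 1)) {w w₁ : UnitCircle → ℝ}
    (hw : IsACWeight μ w) (hw₁ : IsACWeight μ₁ w₁) :
    ∀ᵐ θ ∂arc, ∃ d : ℂ,
      Tendsto (fun r : ℝ => relativeSzego μ μ₁ (r * pt θ)) (𝓝[<] 1) (𝓝 d) ∧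
        ‖d‖ ^ 2 * w₁ θ = w θ := by
  filter_upwards [ae_exists_tendsto_caratheodory_re_eq hw,
    ae_exists_tendsto_caratheodory_re_eq hw₁, hw.2.1, hw₁.2.1]
    with θ ⟨L, hLw, hL⟩ ⟨L₁, hLw₁, hL₁⟩ h0 h0₁
  -- Nonnegative real parts keep the denominators `F + 1` and `F₁ + 1` nonzero in the limit, so the
  -- limit of `δ₀D` exists even where `w` or `w₁` vanishes.
  have hne : ∀ x : ℂ, 0 ≤ x.re → x + 1 ≠ 0 := fun x hx h => by
    have := congrArg Complex.re h
    simp at this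
    linarith
  have hLne : L + 1 ≠ 0 := hne L (by rw [hLw]; exact h0)
  have hLne₁ : L₁ + 1 ≠ 0 := hne L₁ (by rw [hLw₁]; exact h0₁)
  have hpt0 : pt θ ≠ 0 := left_ne_zero_of_mul_eq_one (pt_mul_conj θ)
  have hzlim : Tendsto (fun r : ℝ => (r : ℂ) * pt θ) (𝓝[<] 1) (𝓝 (pt θ)) := by
    have : Continuous fun r : ℝ => (r : ℂ) * pt θ := by fun_prop
    have := this.tendsto 1
    simp only [Complex.ofReal_one, one_mul] at this
    exact this.mono_left nhdsWithin_le_nhds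
  have hIoo := Ioo_mem_nhdsLT (zero_lt_one (α := ℝ))
  have hnorm : ∀ r ∈ Set.Ioo (0 : ℝ) 1, ‖(r : ℂ) * pt θ‖ < 1 := fun r hr => by
    rw [norm_mul_pt hr.1.le]
    exact hr.2
  have hrel : (L - 1 - verblunsky μ 0 * (pt θ * (L + 1))) * (L₁ + 1) =
      (pt θ * (L + 1) - conj (verblunsky μ 0) * (L - 1)) * (L₁ - 1) := by
    refine tendsto_nhds_unique (f := fun r : ℝ => (caratheodory μ (r * pt θ) - 1 -
      verblunsky μ 0 * (r * pt θ * (caratheodory μ (r * pt θ) + 1))) *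
        (caratheodory μ₁ (r * pt θ) + 1)) (l := 𝓝[<] 1) ?_ (Tendsto.congr' ?_
      (((hzlim.mul (hL.add_const 1)).sub ((hL.sub_const 1).const_mul _)).mul (hL₁.sub_const 1)))
    · exact ((hL.sub_const 1).sub ((hzlim.mul (hL.add_const 1)).const_mul _)).mul
        (hL₁.add_const 1)
    · filter_upwards [hIoo] with r hr
      exact (caratheodory_strip hμ hμ₁ hα (hnorm r hr)).symm
  have hid := boundary_identity (norm_pt θ) (norm_verblunsky_zero_lt_one hμ) hLne hLne₁ hrel
  rw [hLw, hLw₁] at hid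
  refine ⟨_, Tendsto.congr' ?_ (((((((hL.sub_const 1).div (hL.add_const 1) hLne).div hzlim
    hpt0).const_mul (conj (verblunsky μ 0))).const_sub 1).div_const
    (Real.sqrt (1 - ‖verblunsky μ 0‖ ^ 2) : ℂ)).mul ((hL.add_const 1).div (hL₁.add_const 1) hLne₁)),
    hid⟩
  filter_upwards [hIoo] with r hr
  have hz0 : (r : ℂ) * pt θ ≠ 0 :=
    mul_ne_zero (by exact_mod_cast hr.1.ne') hpt0
  have h1 := hne _ (re_caratheodory_pos μ (hnorm r hr)).le
  have h2 := hne _ (re_caratheodory_pos μ₁ (hnorm r hr)).le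
  have hs : schur μ (r * pt θ) = (caratheodory μ (r * pt θ) - 1) /
      (caratheodory μ (r * pt θ) + 1) / (r * pt θ) := by
    rw [← mul_schur hz0, mul_div_cancel_left₀ _ hz0]
  -- With `zf = (F - 1) / (F + 1)` this turns `(1 - zf₁) / (1 - zf)` into `(F + 1) / (F₁ + 1)`.
  have hsub : ∀ x : ℂ, x + 1 ≠ 0 → 1 - (x - 1) / (x + 1) = 2 / (x + 1) := fun x hx => by
    field_simp
    ring
  rw [relativeSzego, mul_schur hz0, mul_schur hz0, hsub _ h1, hsub _ h2, hs,
    div_div_div_cancel_left' _ _ two_ne_zero]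
  rfl

end OPUC

theorem theorem4p1
    (μ μ₁ : MeasureTheory.Measure OPUC.UnitCircle)
    [MeasureTheory.IsProbabilityMeasure μ] [MeasureTheory.IsProbabilityMeasure μ₁]
    (hμ : OPUC.IsNontrivial μ) (hμ₁ : OPUC.IsNontrivial μ₁)
    (hα : ∀ j : ℕ, OPUC.verblunsky μ₁ j = OPUC.verblunsky μ (j + 1))
    (w w₁ : OPUC.UnitCircle → ℝ)
    (hw : OPUC.IsACWeight μ w) (hw₁ : OPUC.IsACWeight μ₁ w₁) :
    ∃ δ₀D : OPUC.UnitCircle → ℂ,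
      (∀ᵐ θ ∂OPUC.arc,
        Filter.Tendsto (fun r : ℝ => OPUC.relativeSzego μ μ₁ ((r : ℂ) * OPUC.pt θ))
          (nhdsWithin 1 (Set.Iio 1)) (nhds (δ₀D θ))) ∧
      (∀ᵐ θ ∂OPUC.arc, w θ ≠ 0 → w₁ θ ≠ 0 ∧ w θ / w₁ θ = ‖δ₀D θ‖ ^ 2) := by
  have h := OPUC.ae_exists_tendsto_relativeSzego hμ hμ₁ hα hw hw₁
  refine ⟨fun θ => limUnder (𝓝[<] 1) fun r : ℝ => OPUC.relativeSzego μ μ₁ (r * OPUC.pt θ), ?_, ?_⟩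
  · filter_upwards [h] with θ ⟨d, hd, _⟩
    exact tendsto_nhds_limUnder ⟨d, hd⟩
  · filter_upwards [h] with θ ⟨d, hd, he⟩ hwθ
    have hw₁θ : w₁ θ ≠ 0 := fun h0 => hwθ (by rw [← he, h0, mul_zero])
    refine ⟨hw₁θ, ?_⟩
    rw [hd.limUnder_eq, ← he, mul_div_cancel_right₀ _ hw₁θ]
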